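/- There is an absolute constant $c>0$ with the following property. Let $u_0,u_1:\mathbb R^3\to\mathbb R$ be $C^\infty$ radial functions, regarded also as functions of $r=|x|$, and suppose that for some $r_0>0$ $$(u_0)_r(r_0)+|u_1(r_0)|\ \ge\ \frac1{r_0}.$$ Consider $$u_{tt}-\Delta u=u_t^2-|\nabla u|^2,\qquad u(0)=u_0,\quad u_t(0)=u_1 \qquad (*)$$ on $\mathbb R^{3+1}$. A classical solution of $(*)$ is a $C^2$ function that satisfies $(*)$ pointwise on an open set $D\subseteq\mathbb R^3\times\mathbb R$ which contains $\mathbb R^3\times\{0\}$ and, with each point $(x,t)$, the solid light cone $\{(y,s): s \text{ between } 0 \text{ and } t,\ |y-x|\le|t-s|\}$. Then $(*)$ has a maximal classical solution $u$, on a domain $D$: every classical solution of $(*)$ is defined on a subset of $D$ and coincides with $u$ there. This $u$ is $C^\infty$ on $D$, and it blows up at a time $t_0$ with $0<|t_0|\le r_0$, in the following sense. There are $x_0\in\mathbb R^3$ and $C\in\mathbb R$ (depending on the solution) such that $(x_0,t_0)\notin D$, while $(x_0,t)\in D$ for all $t$ strictly between $0$ and $t_0$, and for all $t$ between $0$ and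 $t_0$ that are sufficiently close to $t_0$ $$\|u(t)\|_{L^\infty(B_t)}\ \ge\ C+\big|\ln|t-t_0|\big|,\qquad \|u(t)\|_{H^{3/2}(B_t)}\ \ge\ c\,\big|\ln|t-t_0|\big|^{1/2},$$ where $B_t=\{x:|x-x_0|\le1,\ (x,t)\in D\}$ is the part of the unit ball around $x_0$ on which $u(t)$ is defined, and $$\|f\|_{H^{3/2}(B)}^2=\int_B|f|^2\,dx+\int_B|\nabla f|^2\,dx+\int_B\int_B\frac{|\nabla f(x)-\nabla f(y)|^2}{|x-y|^4}\,dy\,dx .$$ (Both norms may be infinite.) -/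

import Mathlib

open MeasureTheory Set Filter
open scoped Topology ContDiff ENNReal

/-- Three-dimensional Euclidean space. -/
abbrev E3 : Type := EuclideanSpace ℝ (Fin 3)

/-- `f` depends only on `|x|`. -/
def IsRadial (f : E3 → ℝ) : Prop :=
  ∀ x y : E3, ‖x‖ = ‖y‖ → f x = f y

/-- The function of the radius `r` obtained from a radial function `f`, i.e. `f(r) = f(x)` for
`|x| = r`; its derivative at `r > 0` is the radial derivative `f_r(r)`. -/
noncomputable def radialProfile (f : E3 → ℝ) (r : ℝ) : ℝ :=
  f (EuclideanSpace.single 0 r)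

/-- `D ⊆ ℝ³ × ℝ` contains, with each point `(x, t)`, the whole solid light cone with vertex `(x, t)`
between time `t` and time `0` (backward if `t > 0`, forward if `t < 0`). -/
def LightConeClosed (D : Set (E3 × ℝ)) : Prop :=
  ∀ (x : E3) (t : ℝ), (x, t) ∈ D →
    ∀ (y : E3) (s : ℝ), s ∈ uIcc 0 t → ‖y - x‖ ≤ |t - s| → (y, s) ∈ D

/-- `u` is, on the space-time domain `D`, a classical solution of
`u_tt - Δu = u_t² - |∇u|²`, `u(0) = u₀`, `u_t(0) = u₁`.
The domain is an open neighbourhood of `ℝ³ × {0}` and is determined by the initial data through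
light cones; the values of `u` outside `D` are irrelevant. -/
structure IsClassicalSolution (u₀ u₁ : E3 → ℝ) (D : Set (E3 × ℝ)) (u : E3 → ℝ → ℝ) : Prop where
  isOpen : IsOpen D
  initial_mem : ∀ x : E3, (x, (0 : ℝ)) ∈ D
  lightConeClosed : LightConeClosed D
  contDiffOn : ContDiffOn ℝ 2 (fun p : E3 × ℝ => u p.1 p.2) D
  equation : ∀ (x : E3) (t : ℝ), (x, t) ∈ D →
    deriv (fun s => deriv (fun s' => u x s') s) t - Laplacian.laplacian (fun y => u y t) x
      = (deriv (fun s => u x s) t) ^ 2 - ‖gradient (fun y => u y t) x‖ ^ 2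
  initial_value : ∀ x : E3, u x 0 = u₀ x
  initial_velocity : ∀ x : E3, deriv (fun s => u x s) 0 = u₁ x

/-- `(D, u)` is the solution with data `(u₀, u₁)` on its maximal domain: every classical solution
with the same data lives on a subset of `D` and agrees with `u` there. -/
def IsMaximalSolution (u₀ u₁ : E3 → ℝ) (D : Set (E3 × ℝ)) (u : E3 → ℝ → ℝ) : Prop :=
  IsClassicalSolution u₀ u₁ D u ∧
    ∀ (D' : Set (E3 × ℝ)) (u' : E3 → ℝ → ℝ), IsClassicalSolution u₀ u₁ D' u' →
      D' ⊆ D ∧ ∀ (x : E3) (t : ℝ), (x, t) ∈ D' → u' x t = u x t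

/-- The part of the ball `|x - x₀| ≤ 1` on which the solution with domain `D` is defined at
time `t`. -/
def ballSlice (D : Set (E3 × ℝ)) (x₀ : E3) (t : ℝ) : Set E3 :=
  {x | ‖x - x₀‖ ≤ 1 ∧ (x, t) ∈ D}

/-- The `L^∞(S)` norm, with values in `[0, ∞]`. -/
noncomputable def normLInfty (S : Set E3) (f : E3 → ℝ) : ℝ≥0∞ :=
  eLpNorm f ∞ (volume.restrict S)

/-- The `H^{3/2}(S)` norm, with values in `[0, ∞]`, of a function that is `C¹` in a neighbourhood of
each point of `S ⊆ ℝ³` (Sobolev-Slobodeckij form):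
`‖f‖² = ∫_S |f|² + ∫_S |∇f|² + ∫_S ∫_S |∇f(x) - ∇f(y)|² / |x - y|⁴ dy dx`;
the exponent is `3 + 2 · (1/2) = 4`. -/
noncomputable def normHThreeHalves (S : Set E3) (f : E3 → ℝ) : ℝ≥0∞ :=
  ((∫⁻ x in S, ‖f x‖ₑ ^ 2) + (∫⁻ x in S, ‖gradient f x‖ₑ ^ 2)
    + ∫⁻ x in S, ∫⁻ y in S, ‖gradient f x - gradient f y‖ₑ ^ 2 / ‖x - y‖ₑ ^ 4) ^ (1 / 2 : ℝ)

/-!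
The substitution `v = exp (-u)` turns the equation into the linear wave equation `□v = 0` as long
as `v > 0`. For radial data `v(x, t) = ∫ σ in -1..1, q (t + σ |x|)` with `q = ((r α)' + r β) / 2`,
where `α = exp (-u₀)` and `β = -u₁ exp (-u₀)`. An energy estimate on the light cone gives
uniqueness for the linear equation, so the maximal domain consists of the points whose light cone
lies in `{v > 0}`.

On the time axis `v(0, t) = 2 q(t)`. The hypothesis says that `q ≤ 0` at `r₀` or at `-r₀`, while
`q(0) > 0`; the first zero `t₀` of `q` in that direction is the blow-up time. Near `(0, t₀)` the
smooth function `v` is at most `M |t - t₀|`, which gives the `L^∞` bound.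

For a radial function `F(|x|)` the seminorm of `H^{3/2}` controls `∫ F'(r)² r dr`, because the
gradients at `x` and at points near a direction orthogonal to `x` are nearly orthogonal. Since
`|F'| ≤ F'² r + 1 / (4 r)`, a drop of `F` by `3 L / 4`, with `L = |log |t - t₀||`, between the
radius `|t - t₀|` and a fixed radius costs a multiple of `L`. Hence, for `F = -log v(·, t)`, three
cases remain: `F ≥ L / 8` on a fixed shell, and the `L²` part is large; or `F` drops from about `L`
at radius `|t - t₀|` to `L / 8` in the shell, and the seminorm is large; or `v(·, t)` vanishes on a
small sphere, where `F → ∞` and the seminorm is infinite.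
-/

section Calculus

theorem contDiff_infty_deriv {q : ℝ → ℝ} (hq : ContDiff ℝ ∞ q) : ContDiff ℝ ∞ (deriv q) :=
  (contDiff_infty_iff_deriv.1 hq).2

theorem deriv_odd_of_even {f : ℝ → ℝ} (hf : f.Even) : (deriv f).Odd := fun s => by
  have h := deriv_comp_neg f s
  rw [funext hf] at h
  linarith

theorem deriv_even_of_odd {f : ℝ → ℝ} (hf : f.Odd) : (deriv f).Even := fun s => by
  have h := deriv_comp_neg f s
  rw [funext hf, deriv.fun_neg] at h
  linarith

theorem hasFDerivAt_intervalIntegral_of_continuous_fderiv {H F : Type*} [NormedAddCommGroup H]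
    [NormedSpace ℝ H] [ProperSpace H] [NormedAddCommGroup F] [NormedSpace ℝ F] {a b : ℝ}
    {f : H → ℝ → F} {f' : H → ℝ → H →L[ℝ] F} (hf : ∀ z, Continuous (f z))
    (hf' : Continuous (Function.uncurry f')) (h : ∀ z σ, HasFDerivAt (f · σ) (f' z σ) z) (z : H) :
    HasFDerivAt (fun z => ∫ σ in a..b, f z σ) (∫ σ in a..b, f' z σ) z := by
  obtain ⟨C, hC⟩ := ((isCompact_closedBall z 1).prod
    (isCompact_uIcc (a := a) (b := b))).exists_bound_of_continuousOn hf'.continuousOn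
  exact intervalIntegral.hasFDerivAt_integral_of_dominated_of_fderiv_le (𝕜 := ℝ)
    (bound := fun _ => C) (Metric.closedBall_mem_nhds z one_pos)
    (Eventually.of_forall fun w => (hf w).aestronglyMeasurable) ((hf z).intervalIntegrable a b)
    (hf'.comp (Continuous.prodMk_right z)).aestronglyMeasurable
    (Eventually.of_forall fun σ hσ w hw => hC (w, σ) ⟨hw, uIoc_subset_uIcc hσ⟩)
    intervalIntegrable_const (Eventually.of_forall fun σ _ w _ => h w σ)

theorem hasFDerivAt_norm {E : Type*} [NormedAddCommGroup E] [InnerProductSpace ℝ E] {x : E}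
    (hx : x ≠ 0) : HasFDerivAt (fun y : E => ‖y‖) (‖x‖⁻¹ • innerSL ℝ x) x := by
  have h := (hasStrictFDerivAt_norm_sq x).hasFDerivAt.sqrt (by positivity)
  simp only [Real.sqrt_sq (norm_nonneg _)] at h
  refine h.congr_fderiv ?_
  rw [← Nat.cast_smul_eq_nsmul ℝ 2, smul_smul]
  congr 1
  push_cast
  field_simp

end Calculus

section WeightedMean

/-- The integral mean of `q` over the interval with centre `t` and radius `r`, with the
(unnormalised) weight `(1 - σ²)ᵏ`. Evaluated at `r = |x|` it is the radial solution of the wave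
equation in dimension `2k + 3` with profile `q`. -/
noncomputable def weightedMean (k : ℕ) (q : ℝ → ℝ) (r t : ℝ) : ℝ :=
  ∫ σ in (-1 : ℝ)..1, (1 - σ ^ 2) ^ k * q (t + σ * r)

variable {k : ℕ} {q : ℝ → ℝ}

theorem weightedMean_neg_time (k : ℕ) (q : ℝ → ℝ) (r t : ℝ) :
    weightedMean k q r (-t) = weightedMean k (fun s => q (-s)) r t := by
  have h := intervalIntegral.integral_comp_neg (a := (-1 : ℝ)) (b := 1)
    (fun σ => (1 - σ ^ 2) ^ k * q (-t + σ * r))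
  rw [neg_neg] at h
  rw [weightedMean, weightedMean, ← h]
  refine intervalIntegral.integral_congr fun σ _ => ?_
  ring_nf

theorem weightedMean_half_add {f h : ℝ → ℝ} (hf : Continuous f) (hh : Continuous h) (r t : ℝ) :
    weightedMean k (fun s => (f s + h s) / 2) r t
      = (weightedMean k f r t + weightedMean k h r t) / 2 := by
  unfold weightedMean
  rw [← intervalIntegral.integral_add ((by fun_prop : Continuous _).intervalIntegrable _ _)
    ((by fun_prop : Continuous _).intervalIntegrable _ _), ← intervalIntegral.integral_div]
  refine intervalIntegral.integral_congr fun σ _ => ?_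
  ring

theorem weightedMean_time_zero_of_odd (hq : q.Odd) (r : ℝ) : weightedMean k q r 0 = 0 := by
  have h := weightedMean_neg_time k q r 0
  simp only [neg_zero, hq _] at h
  have hneg : weightedMean k (fun s => -q s) r 0 = -weightedMean k q r 0 := by
    simp only [weightedMean, mul_neg, intervalIntegral.integral_neg]
  linarith

theorem weightedMean_radius_zero (q : ℝ → ℝ) (t : ℝ) : weightedMean 0 q 0 t = 2 * q t := by
  norm_num [weightedMean]

theorem radius_mul_weightedMean (hq : Continuous q) (r t : ℝ) :
    r * weightedMean 0 q r t = (∫ s in (0 : ℝ)..(t + r), q s) - ∫ s in (0 : ℝ)..(t - r), q s := by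
  have h := intervalIntegral.smul_integral_comp_add_mul (a := (-1 : ℝ)) (b := 1) q r t
  rw [mul_neg_one, mul_one, ← sub_eq_add_neg, smul_eq_mul] at h
  simp only [weightedMean, pow_zero, one_mul, mul_comm _ r]
  rw [h, intervalIntegral.integral_interval_sub_left (hq.intervalIntegrable _ _)
    (hq.intervalIntegrable _ _)]

theorem weightedMean_deriv_id_mul_of_even {α : ℝ → ℝ} (hα : ContDiff ℝ 1 α) (heven : α.Even)
    (r : ℝ) : weightedMean 0 (deriv fun s => s * α s) r 0 = 2 * α r := by
  have hid : ContDiff ℝ 1 fun s => s * α s := contDiff_id.mul hα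
  rcases eq_or_ne r 0 with rfl | hr
  · have h : HasDerivAt (fun s => s * α s) (1 * α 0 + 0 * deriv α 0) 0 :=
      (hasDerivAt_id' 0).fun_mul (hα.differentiable one_ne_zero 0).hasDerivAt
    rw [weightedMean_radius_zero, h.deriv, zero_mul, add_zero, one_mul]
  · have hc := hid.continuous_deriv le_rfl
    have h := radius_mul_weightedMean hc r 0
    simp only [intervalIntegral.integral_deriv_eq_sub
      (fun s _ => hid.differentiable one_ne_zero s) (hc.intervalIntegrable _ _),
      zero_add, zero_sub, heven r] at h
    refine mul_left_cancel₀ hr ?_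
    linarith

theorem integral_id_mul_weight_mul {u u' : ℝ → ℝ} (hu : ∀ σ, HasDerivAt u (u' σ) σ)
    (hu' : Continuous u') :
    ∫ σ in (-1 : ℝ)..1, (1 - σ ^ 2) ^ k * (σ * u σ)
      = 1 / (2 * ((k : ℝ) + 1)) * ∫ σ in (-1 : ℝ)..1, (1 - σ ^ 2) ^ (k + 1) * u' σ := by
  have hw : ∀ σ : ℝ, HasDerivAt (fun σ : ℝ => (1 - σ ^ 2) ^ (k + 1))
      (-(2 * (k + 1)) * ((1 - σ ^ 2) ^ k * σ)) σ := fun σ => by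
    refine (((hasDerivAt_pow 2 σ).const_sub 1).fun_pow (k + 1)).congr_deriv ?_
    push_cast
    simp only [pow_one]
    ring
  have h := intervalIntegral.integral_mul_deriv_eq_deriv_mul (a := (-1 : ℝ)) (b := 1)
    (fun σ _ => hu σ) (fun σ _ => hw σ) (hu'.intervalIntegrable _ _)
    ((by fun_prop : Continuous _).intervalIntegrable _ _)
  norm_num at h
  have hk : (2 * ((k : ℝ) + 1)) ≠ 0 := by positivity
  rw [one_div, eq_inv_mul_iff_mul_eq₀ hk, ← intervalIntegral.integral_const_mul]
  simp only [mul_comm _ (u' _), ← h]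
  refine intervalIntegral.integral_congr fun σ _ => ?_
  ring

theorem hasDerivAt_comp_add_mul (hq : Differentiable ℝ q) (r t σ : ℝ) :
    HasDerivAt (fun σ => q (t + σ * r)) (r * deriv q (t + σ * r)) σ := by
  have h : HasDerivAt (fun σ : ℝ => t + σ * r) r σ := by
    simpa only [one_mul] using ((hasDerivAt_id' σ).mul_const r).const_add t
  exact ((hq _).hasDerivAt.comp σ h).congr_deriv (mul_comm _ _)

theorem integral_id_mul_weight_mul_comp (k : ℕ) (hq : ContDiff ℝ 1 q) (r t : ℝ) :
    ∫ σ in (-1 : ℝ)..1, (1 - σ ^ 2) ^ k * (σ * q (t + σ * r))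
      = r / (2 * (k + 1)) * weightedMean (k + 1) (deriv q) r t := by
  have := hq.continuous_deriv le_rfl
  rw [integral_id_mul_weight_mul (hasDerivAt_comp_add_mul (hq.differentiable one_ne_zero) r t)
    (by fun_prop), weightedMean]
  simp only [mul_left_comm _ r, intervalIntegral.integral_const_mul]
  ring

/-- The radial wave equation in dimension `2k + 3`, in integrated form. -/
theorem weightedMean_eq_add_succ (k : ℕ) (hq : ContDiff ℝ 2 q) (r t : ℝ) :
    weightedMean k q r t = (2 * k + 3) / (2 * (k + 1)) * weightedMean (k + 1) q r t
      + r ^ 2 / (4 * (k + 1) * (k + 2)) * weightedMean (k + 2) (deriv (deriv q)) r t := by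
  have hq' : ContDiff ℝ 1 (deriv q) := hq.deriv'
  have hc := hq.continuous
  have hc' := hq'.continuous
  have h := integral_id_mul_weight_mul (k := k)
    (u := fun σ => σ * q (t + σ * r)) (u' := fun σ => q (t + σ * r) + r * (σ * deriv q (t + σ * r)))
    (fun σ => ((hasDerivAt_id' σ).fun_mul (hasDerivAt_comp_add_mul
      (hq.differentiable two_ne_zero) r t σ)).congr_deriv (by ring)) (by fun_prop)
  have hsplit : ∀ σ : ℝ, (1 - σ ^ 2) ^ k * (σ * (σ * q (t + σ * r)))
      = (1 - σ ^ 2) ^ k * q (t + σ * r) - (1 - σ ^ 2) ^ (k + 1) * q (t + σ * r) := fun σ => by ring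
  simp only [hsplit, mul_add, mul_left_comm _ r] at h
  rw [intervalIntegral.integral_sub, intervalIntegral.integral_add,
    intervalIntegral.integral_const_mul, integral_id_mul_weight_mul_comp (k + 1) hq'] at h
  · change weightedMean k q r t - weightedMean (k + 1) q r t
      = _ * (weightedMean (k + 1) q r t + _) at h
    rw [sub_eq_iff_eq_add] at h
    rw [h]
    push_cast
    field_simp
    ring
  all_goals exact (by fun_prop : Continuous _).intervalIntegrable _ _

theorem hasFDerivAt_weightedMean (k : ℕ) (hq : ContDiff ℝ 2 q) (z : ℝ × ℝ) :
    HasFDerivAt (fun z : ℝ × ℝ => weightedMean k q z.1 z.2)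
      ((z.1 / (2 * (k + 1)) * weightedMean (k + 1) (deriv (deriv q)) z.1 z.2) •
          ContinuousLinearMap.fst ℝ ℝ ℝ
        + weightedMean k (deriv q) z.1 z.2 • ContinuousLinearMap.snd ℝ ℝ ℝ) z := by
  have hq' : ContDiff ℝ 1 (deriv q) := hq.deriv'
  have hc := hq.continuous
  have hc' := hq'.continuous
  have hf' : ∀ (w : ℝ × ℝ) (σ : ℝ), HasFDerivAt
      (fun w : ℝ × ℝ => (1 - σ ^ 2) ^ k * q (w.2 + σ * w.1))
      (((1 - σ ^ 2) ^ k * (σ * deriv q (w.2 + σ * w.1))) • ContinuousLinearMap.fst ℝ ℝ ℝ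
        + ((1 - σ ^ 2) ^ k * deriv q (w.2 + σ * w.1)) • ContinuousLinearMap.snd ℝ ℝ ℝ) w := by
    intro w σ
    have h := ((hq.differentiable two_ne_zero (w.2 + σ * w.1)).hasDerivAt.comp_hasFDerivAt w
      (hasFDerivAt_snd.add ((hasFDerivAt_fst (𝕜 := ℝ)).const_mul σ))).const_mul ((1 - σ ^ 2) ^ k)
    refine h.congr_fderiv ?_
    module
  refine (hasFDerivAt_intervalIntegral_of_continuous_fderiv (fun w => by fun_prop)
    (by fun_prop) hf' z).congr_fderiv ?_
  rw [intervalIntegral.integral_add, intervalIntegral.integral_smul_const,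
    intervalIntegral.integral_smul_const, integral_id_mul_weight_mul_comp k hq']
  · rfl
  all_goals exact (by fun_prop : Continuous _).intervalIntegrable _ _

end WeightedMean

section RadialMean

variable {E : Type*} [NormedAddCommGroup E]

/-- The function `(x, t) ↦ weightedMean k q |x| t`. -/
noncomputable def radialMean (k : ℕ) (q : ℝ → ℝ) (p : E × ℝ) : ℝ :=
  weightedMean k q ‖p.1‖ p.2

theorem radialMean_comp_neg (k : ℕ) (q : ℝ → ℝ) (x : E) (t : ℝ) :
    radialMean k (fun s => q (-s)) (x, t) = radialMean k q (x, -t) :=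
  (weightedMean_neg_time k q ‖x‖ t).symm

variable [InnerProductSpace ℝ E]

theorem hasFDerivAt_radialMean (k : ℕ) {q : ℝ → ℝ} (hq : ContDiff ℝ 2 q) (p : E × ℝ) :
    HasFDerivAt (radialMean k q)
      ((1 / (2 * ((k : ℝ) + 1)) * radialMean (k + 1) (deriv (deriv q)) p) •
          ((innerSL ℝ p.1).comp (ContinuousLinearMap.fst ℝ E ℝ))
        + radialMean k (deriv q) p • ContinuousLinearMap.snd ℝ E ℝ) p := by
  have h := hasFDerivAt_weightedMean k hq (‖p.1‖, p.2)
  obtain ⟨x, t⟩ := p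
  rcases eq_or_ne x 0 with rfl | hx
  · rw [hasFDerivAt_iff_isLittleO] at h ⊢
    have hnorm : Tendsto (fun p : E × ℝ => (‖p.1‖, p.2)) (𝓝 (0, t)) (𝓝 (‖(0 : E)‖, t)) :=
      Continuous.tendsto' (by fun_prop) _ _ rfl
    refine ((h.comp_tendsto hnorm).congr_left fun p => ?_).trans_isBigO
      (Asymptotics.IsBigO.of_bound 1 (Eventually.of_forall fun p => ?_))
    · simp [radialMean]
    · simp [Prod.norm_def]
  · have hnorm : HasFDerivAt (fun p : E × ℝ => (‖p.1‖, p.2)) _ (x, t) :=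
      (HasFDerivAt.comp (g := fun y : E => ‖y‖) (x, t) (hasFDerivAt_norm hx)
        hasFDerivAt_fst).prodMk hasFDerivAt_snd
    refine (HasFDerivAt.comp (x, t) h hnorm).congr_fderiv ?_
    have : ‖x‖ ≠ 0 := norm_ne_zero_iff.2 hx
    ext y <;> simp [radialMean]
    field_simp

set_option maxSynthPendingDepth 2 in
theorem contDiff_radialMean (k : ℕ) {q : ℝ → ℝ} (hq : ContDiff ℝ ∞ q) :
    ContDiff ℝ ∞ (radialMean (E := E) k q) := by
  refine contDiff_infty.2 fun n => ?_
  induction n generalizing k q with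
  | zero =>
    exact contDiff_zero.2 (continuous_iff_continuousAt.2 fun p =>
      (hasFDerivAt_radialMean k (contDiff_infty.1 hq 2) p).continuousAt)
  | succ n ih =>
    have hd := hasFDerivAt_radialMean (E := E) k (contDiff_infty.1 hq 2)
    push_cast
    refine contDiff_succ_iff_fderiv.2 ⟨fun p => (hd p).differentiableAt, by simp, ?_⟩
    rw [funext fun p => (hd p).fderiv]
    have hinner : ContDiff ℝ n (fun p : E × ℝ =>
        (innerSL ℝ p.1).comp (ContinuousLinearMap.fst ℝ E ℝ)) :=
      ((innerSL ℝ (E := E)).contDiff.comp contDiff_fst).clm_comp contDiff_const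
    have hspace := ih (k + 1) (contDiff_infty_deriv (contDiff_infty_deriv hq))
    have htime := ih k (contDiff_infty_deriv hq)
    exact ((contDiff_const.mul hspace).smul hinner).add (htime.smul contDiff_const)

end RadialMean

section DirDeriv

variable {H : Type*} [NormedAddCommGroup H] [NormedSpace ℝ H] {F G : H → ℝ} {D : Set H} {p : H}

/-- The derivative of `F` in the direction `a`, as a function of the base point. -/
noncomputable def dirDeriv (a : H) (F : H → ℝ) (p : H) : ℝ := fderiv ℝ F p a

theorem differentiableAt_of_contDiffOn {n : WithTop ℕ∞} (hD : IsOpen D) (hF : ContDiffOn ℝ n F D)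
    (hn : n ≠ 0) (hp : p ∈ D) : DifferentiableAt ℝ F p :=
  (hF.differentiableOn hn).differentiableAt (hD.mem_nhds hp)

theorem eqOn_dirDeriv (hD : IsOpen D) (h : EqOn F G D) (a : H) :
    EqOn (dirDeriv a F) (dirDeriv a G) D := fun p hp => by
  rw [dirDeriv, dirDeriv, (h.eventuallyEq_of_mem (hD.mem_nhds hp)).fderiv_eq]

theorem contDiffOn_dirDeriv {m n : WithTop ℕ∞} (hD : IsOpen D) (hF : ContDiffOn ℝ n F D)
    (hmn : m + 1 ≤ n) (a : H) : ContDiffOn ℝ m (dirDeriv a F) D :=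
  (hF.fderiv_of_isOpen hD hmn).clm_apply contDiffOn_const

theorem contDiff_dirDeriv {m n : WithTop ℕ∞} (hF : ContDiff ℝ n F) (hmn : m + 1 ≤ n) (a : H) :
    ContDiff ℝ m (dirDeriv a F) :=
  (hF.fderiv_right hmn).clm_apply contDiff_const

theorem continuous_dirDeriv (hF : ContDiff ℝ 1 F) (a : H) : Continuous (dirDeriv a F) :=
  (contDiff_dirDeriv (m := 0) hF (zero_add _).le a).continuous

theorem differentiableAt_dirDeriv (hD : IsOpen D) (hF : ContDiffOn ℝ 2 F D) (a : H) (hp : p ∈ D) :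
    DifferentiableAt ℝ (dirDeriv a F) p :=
  differentiableAt_of_contDiffOn hD (contDiffOn_dirDeriv hD hF one_add_one_eq_two.le a)
    one_ne_zero hp

theorem dirDeriv_comm (hF : ContDiff ℝ 2 F) (a b : H) (p : H) :
    dirDeriv a (dirDeriv b F) p = dirDeriv b (dirDeriv a F) p := by
  have hd : DifferentiableAt ℝ (fderiv ℝ F) p :=
    (hF.fderiv_right one_add_one_eq_two.le).differentiable one_ne_zero p
  have happly (c d : H) : dirDeriv c (dirDeriv d F) p = fderiv ℝ (fderiv ℝ F) p c d := by
    change fderiv ℝ (fun q => fderiv ℝ F q d) p c = _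
    rw [fderiv_clm_apply hd (by fun_prop)]
    simp
  rw [happly, happly]
  exact (hF.contDiffAt.isSymmSndFDerivAt (by simp)) a b

theorem dirDeriv_add (hF : DifferentiableAt ℝ F p) (hG : DifferentiableAt ℝ G p) (a : H) :
    dirDeriv a (fun q => F q + G q) p = dirDeriv a F p + dirDeriv a G p := by
  rw [dirDeriv, fderiv_fun_add hF hG]
  rfl

theorem dirDeriv_sub (hF : DifferentiableAt ℝ F p) (hG : DifferentiableAt ℝ G p) (a : H) :
    dirDeriv a (fun q => F q - G q) p = dirDeriv a F p - dirDeriv a G p := by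
  rw [dirDeriv, fderiv_fun_sub hF hG]
  rfl

theorem dirDeriv_mul (hF : DifferentiableAt ℝ F p) (hG : DifferentiableAt ℝ G p) (a : H) :
    dirDeriv a (fun q => F q * G q) p = dirDeriv a F p * G p + F p * dirDeriv a G p := by
  rw [dirDeriv, fderiv_fun_mul hF hG]
  simp only [add_apply, smul_apply, smul_eq_mul, dirDeriv]
  ring

theorem dirDeriv_comp {f : ℝ → ℝ} {f' : ℝ} (hF : DifferentiableAt ℝ F p)
    (hf : HasDerivAt f f' (F p)) (a : H) :
    dirDeriv a (fun q => f (F q)) p = f' * dirDeriv a F p := by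
  have h : HasFDerivAt (fun q => f (F q)) _ p := hf.comp_hasFDerivAt p hF.hasFDerivAt
  rw [dirDeriv, h.fderiv]
  rfl

theorem dirDeriv_sum_sq {ι : Type*} {s : Finset ι} {f : ι → H → ℝ}
    (hf : ∀ i ∈ s, DifferentiableAt ℝ (f i) p) (a : H) :
    dirDeriv a (fun q => ∑ i ∈ s, f i q ^ 2) p = 2 * ∑ i ∈ s, f i p * dirDeriv a (f i) p := by
  rw [dirDeriv, fderiv_fun_sum fun i hi => (hf i hi).fun_pow 2, sum_apply, Finset.mul_sum]
  refine Finset.sum_congr rfl fun i hi => ?_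
  have h := dirDeriv_comp (hf i hi) (hasDerivAt_pow 2 (f i p)) a
  rw [dirDeriv] at h
  rw [h]
  ring

theorem dirDeriv_dirDeriv_comp (hD : IsOpen D) (hF : ContDiffOn ℝ 2 F D) {f f' f'' : ℝ → ℝ}
    (hf : ∀ q ∈ D, HasDerivAt f (f' (F q)) (F q)) (hf' : ∀ q ∈ D, HasDerivAt f' (f'' (F q)) (F q))
    (a : H) (hp : p ∈ D) :
    dirDeriv a (dirDeriv a fun q => f (F q)) p
      = f'' (F p) * dirDeriv a F p ^ 2 + f' (F p) * dirDeriv a (dirDeriv a F) p := by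
  have hd : ∀ q ∈ D, DifferentiableAt ℝ F q := fun _ =>
    differentiableAt_of_contDiffOn hD hF two_ne_zero
  rw [eqOn_dirDeriv hD (fun q hq => dirDeriv_comp (hd q hq) (hf q hq) a) a hp,
    dirDeriv_mul (F := fun q => f' (F q)) ((hf' p hp).differentiableAt.comp p (hd p hp))
      (differentiableAt_dirDeriv hD hF a hp), dirDeriv_comp (hd p hp) (hf' p hp)]
  ring

end DirDeriv

section WaveOperator

variable {E : Type*} [NormedAddCommGroup E]

/-- The time direction of the space-time `E × ℝ`. -/
def timeDir : E × ℝ := (0, 1)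

variable [InnerProductSpace ℝ E] {F G U V : E × ℝ → ℝ} {D : Set (E × ℝ)} {p : E × ℝ}

theorem dirDeriv_time_radialMean (k : ℕ) {q : ℝ → ℝ} (hq : ContDiff ℝ 2 q) :
    dirDeriv timeDir (radialMean (E := E) k q) = radialMean k (deriv q) := by
  funext p
  simp [dirDeriv, timeDir, (hasFDerivAt_radialMean k hq p).fderiv]

theorem dirDeriv_space_radialMean (k : ℕ) {q : ℝ → ℝ} (hq : ContDiff ℝ 2 q) (v : E) :
    dirDeriv (v, 0) (radialMean k q) = fun p =>
      1 / (2 * ((k : ℝ) + 1)) * (radialMean (k + 1) (deriv (deriv q)) p * inner ℝ v p.1) := by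
  funext p
  simp [dirDeriv, (hasFDerivAt_radialMean k hq p).fderiv, real_inner_comm, mul_assoc]

theorem dirDeriv_space_space_radialMean (k : ℕ) {q : ℝ → ℝ} (hq : ContDiff ℝ ∞ q) (v : E)
    (p : E × ℝ) :
    dirDeriv (v, 0) (dirDeriv (v, 0) (radialMean k q)) p = 1 / (2 * ((k : ℝ) + 1))
      * (1 / (2 * ((k : ℝ) + 2)) * radialMean (k + 2) (deriv (deriv (deriv (deriv q)))) p
        * inner ℝ v p.1 ^ 2 + radialMean (k + 1) (deriv (deriv q)) p * ‖v‖ ^ 2) := by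
  have hq'' := contDiff_infty_deriv (contDiff_infty_deriv hq)
  have hinner : HasFDerivAt (fun p : E × ℝ => inner ℝ v p.1)
      ((innerSL ℝ v).comp (ContinuousLinearMap.fst ℝ E ℝ)) p :=
    ((innerSL ℝ v).comp (ContinuousLinearMap.fst ℝ E ℝ)).hasFDerivAt
  have h := ((hasFDerivAt_radialMean (k + 1) (contDiff_infty.1 hq'' 2) p).fun_mul
    hinner).const_mul (1 / (2 * ((k : ℝ) + 1)))
  rw [dirDeriv_space_radialMean k (contDiff_infty.1 hq 2), dirDeriv, h.fderiv]
  simp [real_inner_comm v]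
  ring_nf

variable [FiniteDimensional ℝ E]

/-- The `i`-th direction of the standard orthonormal basis of `E`, in the space-time `E × ℝ`. -/
noncomputable def spaceDir (i : Fin (Module.finrank ℝ E)) : E × ℝ := (stdOrthonormalBasis ℝ E i, 0)

/-- The d'Alembert operator `∂²/∂t² - Δ` on the space-time `E × ℝ`. -/
noncomputable def waveOp (F : E × ℝ → ℝ) (p : E × ℝ) : ℝ :=
  dirDeriv timeDir (dirDeriv timeDir F) p - ∑ i, dirDeriv (spaceDir i) (dirDeriv (spaceDir i) F) p

/-- The quadratic form `u_t² - |∇u|²`. -/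
noncomputable def nullForm (F : E × ℝ → ℝ) (p : E × ℝ) : ℝ :=
  dirDeriv timeDir F p ^ 2 - ∑ i, dirDeriv (spaceDir i) F p ^ 2

theorem waveOp_radialMean {k : ℕ} (hk : Module.finrank ℝ E = 2 * k + 3) {q : ℝ → ℝ}
    (hq : ContDiff ℝ ∞ q) (p : E × ℝ) : waveOp (radialMean k q) p = 0 := by
  have hq' := contDiff_infty_deriv hq
  have hq'' := contDiff_infty_deriv hq'
  have hnorm := OrthonormalBasis.sum_sq_inner_right (stdOrthonormalBasis ℝ E) p.1
  have hpde := weightedMean_eq_add_succ k (contDiff_infty.1 hq'' 2) ‖p.1‖ p.2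
  rw [waveOp, dirDeriv_time_radialMean k (contDiff_infty.1 hq 2),
    dirDeriv_time_radialMean k (contDiff_infty.1 hq' 2)]
  simp only [spaceDir, dirDeriv_space_space_radialMean k hq, OrthonormalBasis.norm_eq_one, one_pow,
    mul_one, ← Finset.mul_sum, Finset.sum_add_distrib, hnorm, Finset.sum_const, Finset.card_univ,
    Fintype.card_fin, hk, nsmul_eq_mul, radialMean]
  rw [hpde]
  push_cast
  field_simp
  ring

theorem eqOn_waveOp (hD : IsOpen D) (h : EqOn F G D) : EqOn (waveOp F) (waveOp G) D :=
  fun p hp => by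
  simp only [waveOp, fun a => eqOn_dirDeriv hD (eqOn_dirDeriv hD h a) a hp]

theorem waveOp_sub (hD : IsOpen D) (hF : ContDiffOn ℝ 2 F D) (hG : ContDiffOn ℝ 2 G D)
    (hp : p ∈ D) : waveOp (fun q => F q - G q) p = waveOp F p - waveOp G p := by
  have h : ∀ a, dirDeriv a (dirDeriv a fun q => F q - G q) p
      = dirDeriv a (dirDeriv a F) p - dirDeriv a (dirDeriv a G) p := fun a => by
    rw [eqOn_dirDeriv hD (fun q hq => dirDeriv_sub
      (differentiableAt_of_contDiffOn hD hF two_ne_zero hq)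
      (differentiableAt_of_contDiffOn hD hG two_ne_zero hq) a) a hp,
      dirDeriv_sub (differentiableAt_dirDeriv hD hF a hp) (differentiableAt_dirDeriv hD hG a hp)]
  simp only [waveOp, h, Finset.sum_sub_distrib]
  ring

theorem waveOp_comp (hD : IsOpen D) (hU : ContDiffOn ℝ 2 U D) {f f' f'' : ℝ → ℝ}
    (hf : ∀ q ∈ D, HasDerivAt f (f' (U q)) (U q)) (hf' : ∀ q ∈ D, HasDerivAt f' (f'' (U q)) (U q))
    (hp : p ∈ D) :
    waveOp (fun q => f (U q)) p = f'' (U p) * nullForm U p + f' (U p) * waveOp U p := by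
  simp only [waveOp, nullForm, dirDeriv_dirDeriv_comp hD hU hf hf' _ hp, Finset.sum_add_distrib,
    ← Finset.mul_sum]
  ring

theorem nullForm_comp {f : ℝ → ℝ} {f' : ℝ} (hU : DifferentiableAt ℝ U p)
    (hf : HasDerivAt f f' (U p)) : nullForm (fun q => f (U q)) p = f' ^ 2 * nullForm U p := by
  simp only [nullForm, dirDeriv_comp hU hf, mul_pow, ← Finset.mul_sum]
  ring

theorem waveOp_exp_neg (hD : IsOpen D) (hU : ContDiffOn ℝ 2 U D) (hp : p ∈ D)
    (h : waveOp U p = nullForm U p) : waveOp (fun q => Real.exp (-U q)) p = 0 := by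
  have hexp : ∀ s : ℝ, HasDerivAt (fun s => Real.exp (-s)) (-Real.exp (-s)) s := fun s => by
    simpa using (hasDerivAt_neg s).exp
  rw [waveOp_comp hD hU (f := fun s => Real.exp (-s)) (f' := fun s => -Real.exp (-s))
    (f'' := fun s => Real.exp (-s)) (fun q _ => hexp _)
    (fun q _ => by simpa using (hexp (U q)).fun_neg) hp, h]
  ring

theorem waveOp_neg_log (hD : IsOpen D) (hV : ContDiffOn ℝ 2 V D) (hpos : ∀ q ∈ D, 0 < V q)
    (hp : p ∈ D) (h : waveOp V p = 0) :
    waveOp (fun q => -Real.log (V q)) p = nullForm (fun q => -Real.log (V q)) p := by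
  have hlog : ∀ q ∈ D, HasDerivAt (fun s => -Real.log s) (-(V q)⁻¹) (V q) := fun q hq =>
    (Real.hasDerivAt_log (hpos q hq).ne').neg
  have hinv : ∀ q ∈ D, HasDerivAt (fun s : ℝ => -s⁻¹) ((V q ^ 2)⁻¹) (V q) := fun q hq => by
    simpa using (hasDerivAt_inv (hpos q hq).ne').fun_neg
  rw [waveOp_comp hD hV (f := fun s => -Real.log s) (f' := fun s => -s⁻¹)
    (f'' := fun s => (s ^ 2)⁻¹) hlog hinv hp, h, nullForm_comp (f := fun s => -Real.log s)
    (differentiableAt_of_contDiffOn hD hV two_ne_zero hp) (hlog p hp)]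
  ring

end WaveOperator

section Slices

variable {E : Type*} [NormedAddCommGroup E] [NormedSpace ℝ E] {U : E × ℝ → ℝ} {D : Set (E × ℝ)}
  {x : E} {t : ℝ}

theorem deriv_slice (hU : DifferentiableAt ℝ U (x, t)) :
    deriv (fun s => U (x, s)) t = dirDeriv timeDir U (x, t) :=
  (hU.hasFDerivAt.comp_hasDerivAt t ((hasDerivAt_const t x).prodMk (hasDerivAt_id t))).deriv

theorem fderiv_slice (hU : DifferentiableAt ℝ U (x, t)) (v : E) :
    fderiv ℝ (fun y => U (y, t)) x v = dirDeriv (v, 0) U (x, t) := by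
  have h : HasFDerivAt (fun y => U (y, t)) _ x :=
    hU.hasFDerivAt.comp x (hasFDerivAt_prodMk_left x t)
  rw [h.fderiv]
  rfl

theorem deriv_deriv_slice (hD : IsOpen D) (hU : ContDiffOn ℝ 2 U D) (hp : (x, t) ∈ D) :
    deriv (fun s => deriv (fun s' => U (x, s')) s) t
      = dirDeriv timeDir (dirDeriv timeDir U) (x, t) := by
  have hev : (fun s => deriv (fun s' => U (x, s')) s)
      =ᶠ[𝓝 t] fun s => dirDeriv timeDir U (x, s) := by
    filter_upwards [(Continuous.prodMk_right x).continuousAt.eventually (hD.mem_nhds hp)] with s hs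
    exact deriv_slice (differentiableAt_of_contDiffOn hD hU two_ne_zero hs)
  rw [hev.deriv_eq]
  exact deriv_slice (differentiableAt_dirDeriv hD hU timeDir hp)

theorem fderiv_fderiv_slice (hD : IsOpen D) (hU : ContDiffOn ℝ 2 U D) (hp : (x, t) ∈ D) (v : E) :
    fderiv ℝ (fderiv ℝ fun y => U (y, t)) x v v
      = dirDeriv (v, 0) (dirDeriv (v, 0) U) (x, t) := by
  have hslice : ContDiffAt ℝ 2 (fun y => U (y, t)) x :=
    (hU.contDiffAt (hD.mem_nhds hp)).comp x (by fun_prop)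
  have happly : fderiv ℝ (fderiv ℝ fun y => U (y, t)) x v v
      = fderiv ℝ (fun z => fderiv ℝ (fun y => U (y, t)) z v) x v := by
    rw [fderiv_clm_apply ((hslice.fderiv_right one_add_one_eq_two.le).differentiableAt
      one_ne_zero) (by fun_prop)]
    simp
  have hev : (fun z => fderiv ℝ (fun y => U (y, t)) z v) =ᶠ[𝓝 x]
      fun z => dirDeriv (v, 0) U (z, t) := by
    filter_upwards [(Continuous.prodMk_left t).continuousAt.eventually (hD.mem_nhds hp)] with z hz
    exact fderiv_slice (differentiableAt_of_contDiffOn hD hU two_ne_zero hz) v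
  rw [happly, hev.fderiv_eq]
  exact fderiv_slice (differentiableAt_dirDeriv hD hU (v, 0) hp) v

end Slices

section NullFormEquation

variable {E : Type*} [NormedAddCommGroup E] [InnerProductSpace ℝ E] [FiniteDimensional ℝ E]
  {U : E × ℝ → ℝ} {D : Set (E × ℝ)} {x : E} {t : ℝ}

theorem norm_gradient_slice_sq (hU : DifferentiableAt ℝ U (x, t)) :
    ‖gradient (fun y => U (y, t)) x‖ ^ 2 = ∑ i, dirDeriv (spaceDir i) U (x, t) ^ 2 := by
  rw [← OrthonormalBasis.sum_sq_inner_left (stdOrthonormalBasis ℝ E)]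
  simp only [gradient, InnerProductSpace.toDual_symm_apply, fderiv_slice hU, spaceDir]

theorem laplacian_slice (hD : IsOpen D) (hU : ContDiffOn ℝ 2 U D) (hp : (x, t) ∈ D) :
    Laplacian.laplacian (fun y => U (y, t)) x
      = ∑ i, dirDeriv (spaceDir i) (dirDeriv (spaceDir i) U) (x, t) := by
  rw [InnerProductSpace.laplacian_eq_iteratedFDeriv_orthonormalBasis _ (stdOrthonormalBasis ℝ E)]
  simp only [iteratedFDeriv_two_apply, Matrix.cons_val_zero, Matrix.cons_val_one,
    fderiv_fderiv_slice hD hU hp, spaceDir]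

theorem equation_iff_waveOp_eq_nullForm (hD : IsOpen D) (hU : ContDiffOn ℝ 2 U D)
    (hp : (x, t) ∈ D) :
    (deriv (fun s => deriv (fun s' => U (x, s')) s) t - Laplacian.laplacian (fun y => U (y, t)) x
      = (deriv (fun s => U (x, s)) t) ^ 2 - ‖gradient (fun y => U (y, t)) x‖ ^ 2)
      ↔ waveOp U (x, t) = nullForm U (x, t) := by
  have hd := differentiableAt_of_contDiffOn hD hU two_ne_zero hp
  rw [deriv_deriv_slice hD hU hp, laplacian_slice hD hU hp, deriv_slice hd,
    norm_gradient_slice_sq hd, waveOp, nullForm]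

end NullFormEquation

section LightCone

variable {E : Type*} [NormedAddCommGroup E]

/-- The solid light cone with vertex `p` between the time of `p` and time `0`: the backward cone
if `p.2 > 0`, the forward cone if `p.2 < 0`. -/
def lightCone (p : E × ℝ) : Set (E × ℝ) :=
  {q | q.2 ∈ uIcc 0 p.2 ∧ ‖q.1 - p.1‖ ≤ |p.2 - q.2|}

theorem self_mem_lightCone (p : E × ℝ) : p ∈ lightCone p :=
  ⟨right_mem_uIcc, by simp⟩

theorem lightCone_time_zero (x : E) : lightCone (x, (0 : ℝ)) = {(x, 0)} := by
  ext ⟨y, s⟩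
  simp only [lightCone, uIcc_self, mem_ofPred_eq, mem_singleton_iff, Prod.mk.injEq]
  refine ⟨fun ⟨hs, hy⟩ => ⟨?_, hs⟩, fun ⟨hy, hs⟩ => ⟨hs, by simp [hy]⟩⟩
  simpa [hs, sub_eq_zero] using hy

theorem lightCone_subset_lightCone {p q : E × ℝ} (hq : q ∈ lightCone p) :
    lightCone q ⊆ lightCone p := fun z hz => by
  refine ⟨uIcc_subset_uIcc left_mem_uIcc hq.1 hz.1, ?_⟩
  have hsplit : |p.2 - q.2| + |q.2 - z.2| = |p.2 - z.2| := by
    rcases mem_uIcc.1 hq.1 with h | h <;> rcases mem_uIcc.1 hz.1 with h' | h'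
    · rw [abs_of_nonneg, abs_of_nonneg, abs_of_nonneg] <;> linarith
    · rw [abs_of_nonneg, abs_of_nonpos, abs_of_nonneg] <;> linarith
    · rw [abs_of_nonpos, abs_of_nonneg, abs_of_nonpos] <;> linarith
    · rw [abs_of_nonpos, abs_of_nonpos, abs_of_nonpos] <;> linarith
  calc ‖z.1 - p.1‖ ≤ ‖z.1 - q.1‖ + ‖q.1 - p.1‖ := norm_sub_le_norm_sub_add_norm_sub _ _ _
    _ ≤ |p.2 - z.2| := by linarith [hq.2, hz.2]

variable [NormedSpace ℝ E]

/-- The parametrisation of `lightCone p` by the pairs `(e, l)` with `|e| ≤ 1` and `0 ≤ l ≤ 1`. -/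
def lightConeParam (p k : E × ℝ) : E × ℝ :=
  (p.1 + |p.2 - k.2 * p.2| • k.1, k.2 * p.2)

theorem continuous_lightConeParam :
    Continuous fun z : (E × ℝ) × (E × ℝ) => lightConeParam z.1 z.2 := by
  unfold lightConeParam
  fun_prop

theorem lightCone_eq_image_lightConeParam (p : E × ℝ) :
    lightCone p = lightConeParam p '' (Metric.closedBall 0 1 ×ˢ Icc 0 1) := by
  obtain ⟨x, t⟩ := p
  ext ⟨y, s⟩
  constructor
  · rintro ⟨hs, hy⟩
    rw [← segment_eq_uIcc, segment_eq_image] at hs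
    obtain ⟨l, hl, rfl⟩ := hs
    simp only [mul_zero, zero_add, smul_eq_mul] at hy ⊢
    refine ⟨(|t - l * t|⁻¹ • (y - x), l), ⟨?_, hl⟩, Prod.ext ?_ rfl⟩
    · rw [mem_closedBall_zero_iff, norm_smul, norm_inv, Real.norm_eq_abs, abs_abs]
      exact inv_mul_le_one_of_le₀ hy (abs_nonneg _)
    · have hzero : |t - l * t| = 0 → y - x = 0 := fun h =>
        norm_le_zero_iff.1 (hy.trans_eq h)
      by_cases h : |t - l * t| = 0
      · simp [lightConeParam, h, sub_eq_zero.1 (hzero h)]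
      · simp [lightConeParam, smul_inv_smul₀ h]
  · rintro ⟨⟨e, l⟩, ⟨he, hl⟩, h⟩
    obtain ⟨rfl, rfl⟩ := Prod.mk.inj h
    rw [mem_closedBall_zero_iff] at he
    refine ⟨?_, ?_⟩
    · rw [← segment_eq_uIcc, segment_eq_image]
      exact ⟨l, hl, by simp⟩
    · simp only [add_sub_cancel_left, norm_smul, Real.norm_eq_abs, abs_abs]
      exact mul_le_of_le_one_right (abs_nonneg _) he

variable [ProperSpace E]

theorem isCompact_lightCone (p : E × ℝ) : IsCompact (lightCone p) := by
  rw [lightCone_eq_image_lightConeParam]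
  exact ((isCompact_closedBall _ _).prod isCompact_Icc).image
    (continuous_lightConeParam.comp (Continuous.prodMk_right p))

theorem isOpen_setOf_lightCone_subset {O : Set (E × ℝ)} (hO : IsOpen O) :
    IsOpen {p | lightCone p ⊆ O} := by
  simp only [lightCone_eq_image_lightConeParam, image_subset_iff]
  refine isOpen_iff_mem_nhds.2 fun p hp => ?_
  exact ((isCompact_closedBall _ _).prod isCompact_Icc).eventually_forall_of_forall_eventually
    fun k hk => (continuous_lightConeParam.continuousAt (x := (p, k))).eventually
      (hO.mem_nhds (hp hk))

end LightCone

section SpaceTimeIntegrals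

variable {E : Type*} [NormedAddCommGroup E] [NormedSpace ℝ E] [FiniteDimensional ℝ E]
  [MeasurableSpace E] [BorelSpace E] {μ : Measure E} [μ.IsAddHaarMeasure]

theorem integral_fderiv_apply_eq_zero {f : E → ℝ} (hf : ContDiff ℝ 1 f) (hs : HasCompactSupport f)
    (v : E) : ∫ y, fderiv ℝ f y v ∂μ = 0 := by
  have hc : Continuous fun y => fderiv ℝ f y v :=
    (hf.continuous_fderiv one_ne_zero).clm_apply continuous_const
  simpa using integral_mul_fderiv_eq_neg_fderiv_mul_of_integrable (𝕜 := ℝ) (μ := μ)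
    (f := f) (g := fun _ => (1 : ℝ)) (v := v)
    (by simpa using hc.integrable_of_hasCompactSupport (hs.fderiv_apply ℝ v)) (by simp)
    (by simpa using hf.continuous.integrable_of_hasCompactSupport hs)
    (fun x _ => hf.differentiable one_ne_zero x) (fun x _ => by fun_prop)

variable {F : E × ℝ → ℝ} {K : Set E} {T : ℝ}

theorem setIntegral_dirDeriv_time_eq_zero (hF : ContDiff ℝ 1 F) (hK : IsCompact K) (hT : 0 ≤ T)
    (h0 : ∀ y ∈ K, F (y, 0) = 0) (hend : ∀ y ∈ K, F (y, T) = 0) :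
    ∫ p in K ×ˢ Icc 0 T, dirDeriv timeDir F p ∂(μ.prod volume) = 0 := by
  have hc := continuous_dirDeriv hF timeDir
  rw [setIntegral_prod _ (hc.continuousOn.integrableOn_compact (hK.prod isCompact_Icc))]
  refine setIntegral_eq_zero_of_forall_eq_zero fun y hy => ?_
  have hderiv : ∀ s, HasDerivAt (fun s => F (y, s)) (dirDeriv timeDir F (y, s)) s := fun s =>
    (hF.differentiable one_ne_zero (y, s)).hasFDerivAt.comp_hasDerivAt s
      ((hasDerivAt_const s y).prodMk (hasDerivAt_id s))
  rw [integral_Icc_eq_integral_Ioc, ← intervalIntegral.integral_of_le hT,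
    intervalIntegral.integral_eq_sub_of_hasDerivAt (fun s _ => hderiv s)
      ((hc.comp (Continuous.prodMk_right y)).intervalIntegrable _ _), h0 y hy, hend y hy, sub_self]

theorem setIntegral_dirDeriv_space_eq_zero (hF : ContDiff ℝ 1 F) (hK : IsCompact K)
    (hout : ∀ s ∈ Icc 0 T, ∀ y ∉ K, F (y, s) = 0) (v : E) :
    ∫ p in K ×ˢ Icc 0 T, dirDeriv (v, 0) F p ∂(μ.prod volume) = 0 := by
  have hint : IntegrableOn (dirDeriv (v, 0) F) (K ×ˢ Icc 0 T) (μ.prod volume) :=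
    (continuous_dirDeriv hF _).continuousOn.integrableOn_compact (hK.prod isCompact_Icc)
  rw [← setIntegral_prod_swap,
    setIntegral_prod (fun z : ℝ × E => dirDeriv (v, 0) F z.swap) hint.swap]
  refine setIntegral_eq_zero_of_forall_eq_zero fun s hs => ?_
  simp only [Prod.swap_prod_mk, ← fderiv_slice (hF.differentiable one_ne_zero _)]
  rw [setIntegral_eq_integral_of_forall_compl_eq_zero fun y hy => ?_]
  · exact integral_fderiv_apply_eq_zero (hF.comp (by fun_prop))
      (HasCompactSupport.intro hK (hout s hs)) v
  · have hev : (fun y => F (y, s)) =ᶠ[𝓝 y] fun _ => 0 := by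
      filter_upwards [hK.isClosed.isOpen_compl.mem_nhds hy] with z hz
      exact hout s hs z hz
    rw [hev.fderiv_eq, fderiv_fun_const]
    rfl

end SpaceTimeIntegrals

section Energy

variable {E : Type*} [NormedAddCommGroup E]

/-- The quadratic function whose positivity set is the interior of the double light cone with
vertex `(x₀, T)`. -/
def coneQuad (x₀ : E) (T : ℝ) (p : E × ℝ) : ℝ := (T - p.2) ^ 2 - ‖p.1 - x₀‖ ^ 2

/-- A smooth weight which is positive inside the double light cone with vertex `(x₀, T)` and
vanishes outside. -/
noncomputable def coneWeight (x₀ : E) (T : ℝ) (p : E × ℝ) : ℝ := expNegInvGlue (coneQuad x₀ T p)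

variable {x₀ : E} {T : ℝ} {p : E × ℝ}

theorem coneQuad_pos_iff : 0 < coneQuad x₀ T p ↔ ‖p.1 - x₀‖ < |T - p.2| := by
  rw [coneQuad, sub_pos, sq_lt_sq, abs_norm]

theorem coneWeight_eq_zero_iff : coneWeight x₀ T p = 0 ↔ |T - p.2| ≤ ‖p.1 - x₀‖ := by
  rw [coneWeight, expNegInvGlue.zero_iff_nonpos, ← not_lt, coneQuad_pos_iff, not_lt]

variable [InnerProductSpace ℝ E]

theorem contDiff_coneQuad {n : WithTop ℕ∞} (x₀ : E) (T : ℝ) : ContDiff ℝ n (coneQuad x₀ T) :=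
  ((contDiff_const.sub contDiff_snd).pow 2).sub ((contDiff_fst.sub contDiff_const).norm_sq ℝ)

theorem contDiff_coneWeight (x₀ : E) (T : ℝ) : ContDiff ℝ 1 (coneWeight x₀ T) :=
  expNegInvGlue.contDiff.comp (contDiff_coneQuad x₀ T)

theorem hasFDerivAt_coneQuad (x₀ : E) (T : ℝ) (p : E × ℝ) :
    HasFDerivAt (coneQuad x₀ T) ((-(2 * (T - p.2))) • ContinuousLinearMap.snd ℝ E ℝ
      - (2 : ℝ) • (innerSL ℝ (p.1 - x₀)).comp (ContinuousLinearMap.fst ℝ E ℝ)) p := by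
  have htime : HasFDerivAt (fun p : E × ℝ => T - p.2) (-ContinuousLinearMap.snd ℝ E ℝ) p :=
    hasFDerivAt_snd.const_sub T
  have hspace : HasFDerivAt (fun p : E × ℝ => p.1 - x₀) (ContinuousLinearMap.fst ℝ E ℝ) p :=
    hasFDerivAt_fst.sub_const x₀
  refine ((htime.pow 2).sub hspace.norm_sq).congr_fderiv ?_
  ext <;> simp

theorem hasDerivAt_expNegInvGlue (s : ℝ) :
    HasDerivAt expNegInvGlue (s⁻¹ ^ 2 * expNegInvGlue s) s := by
  simpa using expNegInvGlue.hasDerivAt_polynomial_eval_inv_mul 1 s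

theorem dirDeriv_coneWeight (x₀ : E) (T : ℝ) (p a : E × ℝ) :
    dirDeriv a (coneWeight x₀ T) p = (coneQuad x₀ T p)⁻¹ ^ 2 * coneWeight x₀ T p
      * (-2 * ((T - p.2) * a.2 + inner ℝ (p.1 - x₀) a.1)) := by
  have hQ := hasFDerivAt_coneQuad x₀ T p
  unfold coneWeight
  rw [dirDeriv_comp hQ.differentiableAt (hasDerivAt_expNegInvGlue _), dirDeriv, hQ.fderiv]
  simp only [sub_apply, smul_apply, ContinuousLinearMap.coe_snd', ContinuousLinearMap.comp_apply,
    ContinuousLinearMap.coe_fst', innerSL_apply_apply, smul_eq_mul]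
  ring

variable [FiniteDimensional ℝ E] {Z : E × ℝ → ℝ}

/-- The energy density `u_t² + |∇u|²`. -/
noncomputable def energyDensity (Z : E × ℝ → ℝ) (p : E × ℝ) : ℝ :=
  dirDeriv timeDir Z p ^ 2 + ∑ i, dirDeriv (spaceDir i) Z p ^ 2

/-- The component `u_t ∂ᵢu` of the energy flux `u_t ∇u`. -/
noncomputable def energyFlux (Z : E × ℝ → ℝ) (i : Fin (Module.finrank ℝ E)) (p : E × ℝ) : ℝ :=
  dirDeriv timeDir Z p * dirDeriv (spaceDir i) Z p

/-- The space-time divergence of the energy current multiplied by `coneWeight x₀ T`. -/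
noncomputable def weightedEnergyDiv (x₀ : E) (T : ℝ) (Z : E × ℝ → ℝ) (p : E × ℝ) : ℝ :=
  dirDeriv timeDir (fun q => coneWeight x₀ T q * energyDensity Z q) p
    - 2 * ∑ i, dirDeriv (spaceDir i) (fun q => coneWeight x₀ T q * energyFlux Z i q) p

theorem contDiff_energyDensity (hZ : ContDiff ℝ 2 Z) : ContDiff ℝ 1 (energyDensity Z) := by
  have hd := fun a => contDiff_dirDeriv (m := 1) hZ one_add_one_eq_two.le a
  exact ((hd _).pow 2).add (ContDiff.sum fun i _ => (hd _).pow 2)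

theorem contDiff_energyFlux (hZ : ContDiff ℝ 2 Z) (i : Fin (Module.finrank ℝ E)) :
    ContDiff ℝ 1 (energyFlux Z i) := by
  have hd := fun a => contDiff_dirDeriv (m := 1) hZ one_add_one_eq_two.le a
  exact (hd _).mul (hd _)

theorem dirDeriv_time_energyDensity_sub (hZ : ContDiff ℝ 2 Z) (p : E × ℝ) :
    dirDeriv timeDir (energyDensity Z) p - 2 * ∑ i, dirDeriv (spaceDir i) (energyFlux Z i) p
      = 2 * dirDeriv timeDir Z p * waveOp Z p := by
  have hd := fun a => (contDiff_dirDeriv (m := 1) hZ one_add_one_eq_two.le a).differentiable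
    one_ne_zero p
  have htime : dirDeriv timeDir (energyDensity Z) p
      = 2 * dirDeriv timeDir Z p * dirDeriv timeDir (dirDeriv timeDir Z) p
        + 2 * ∑ i, dirDeriv (spaceDir i) Z p * dirDeriv timeDir (dirDeriv (spaceDir i) Z) p := by
    unfold energyDensity
    rw [dirDeriv_add ((hd _).fun_pow 2) (DifferentiableAt.fun_sum fun i _ => (hd _).fun_pow 2),
      dirDeriv_sum_sq fun i _ => hd (spaceDir i),
      dirDeriv_comp (f := fun s => s ^ 2) (hd _) (hasDerivAt_pow 2 _)]
    norm_num
  rw [htime]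
  unfold energyFlux
  simp only [dirDeriv_mul (hd timeDir) (hd (spaceDir _)), dirDeriv_comm hZ timeDir (spaceDir _),
    Finset.sum_add_distrib, ← Finset.mul_sum, waveOp, mul_comm (dirDeriv (spaceDir _) Z p)]
  ring

theorem weightedEnergyDiv_eq (hZ : ContDiff ℝ 2 Z) (p : E × ℝ) :
    weightedEnergyDiv x₀ T Z p
      = 2 * ((coneQuad x₀ T p)⁻¹ ^ 2 * coneWeight x₀ T p) * (2 * dirDeriv timeDir Z p
          * ∑ i, inner ℝ (p.1 - x₀) (stdOrthonormalBasis ℝ E i) * dirDeriv (spaceDir i) Z p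
        - (T - p.2) * energyDensity Z p)
      + 2 * coneWeight x₀ T p * dirDeriv timeDir Z p * waveOp Z p := by
  have hweight := (contDiff_coneWeight x₀ T).differentiable one_ne_zero p
  have hdensity := (contDiff_energyDensity hZ).differentiable one_ne_zero p
  have hflux := fun i => (contDiff_energyFlux hZ i).differentiable one_ne_zero p
  have hsum : ∑ i, dirDeriv (spaceDir i) (fun q => coneWeight x₀ T q * energyFlux Z i q) p
      = -2 * ((coneQuad x₀ T p)⁻¹ ^ 2 * coneWeight x₀ T p) * dirDeriv timeDir Z p
          * ∑ i, inner ℝ (p.1 - x₀) (stdOrthonormalBasis ℝ E i) * dirDeriv (spaceDir i) Z p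
        + coneWeight x₀ T p * ∑ i, dirDeriv (spaceDir i) (energyFlux Z i) p := by
    rw [Finset.mul_sum, Finset.mul_sum, ← Finset.sum_add_distrib]
    refine Finset.sum_congr rfl fun i _ => ?_
    rw [dirDeriv_mul hweight (hflux i), dirDeriv_coneWeight]
    simp only [spaceDir, energyFlux, mul_zero, zero_add]
    ring
  have htime : dirDeriv timeDir (coneWeight x₀ T) p
      = (coneQuad x₀ T p)⁻¹ ^ 2 * coneWeight x₀ T p * (-2 * (T - p.2)) := by
    simp [dirDeriv_coneWeight, timeDir]
  rw [weightedEnergyDiv, hsum, dirDeriv_mul hweight hdensity, htime]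
  linear_combination coneWeight x₀ T p * dirDeriv_time_energyDensity_sub hZ p

/-- Expand `0 ≤ ∑ (d bᵢ - a wᵢ)²`. -/
theorem two_mul_sum_mul_le {ι : Type*} {s : Finset ι} (b w : ι → ℝ) (a : ℝ) {d : ℝ} (hd : 0 < d)
    (hw : ∑ i ∈ s, w i ^ 2 ≤ d ^ 2) :
    2 * a * ∑ i ∈ s, w i * b i ≤ d * (a ^ 2 + ∑ i ∈ s, b i ^ 2) := by
  have hsq : 0 ≤ ∑ i ∈ s, (d * b i - a * w i) ^ 2 := Finset.sum_nonneg fun i _ => sq_nonneg _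
  have hexpand : ∑ i ∈ s, (d * b i - a * w i) ^ 2
      = d ^ 2 * ∑ i ∈ s, b i ^ 2 - 2 * d * a * ∑ i ∈ s, w i * b i + a ^ 2 * ∑ i ∈ s, w i ^ 2 := by
    simp only [Finset.mul_sum, ← Finset.sum_sub_distrib, ← Finset.sum_add_distrib]
    exact Finset.sum_congr rfl fun i _ => by ring
  refine le_of_mul_le_mul_left ?_ hd
  nlinarith [mul_le_mul_of_nonneg_left hw (sq_nonneg a)]

theorem weightedEnergyDiv_nonpos (hZ : ContDiff ℝ 2 Z)
    (hwave : ‖p.1 - x₀‖ ≤ |T - p.2| → waveOp Z p = 0) (hp : p.2 ≤ T) :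
    weightedEnergyDiv x₀ T Z p ≤ 0 := by
  rw [weightedEnergyDiv_eq hZ]
  rcases le_or_gt |T - p.2| ‖p.1 - x₀‖ with h | h
  · simp [coneWeight_eq_zero_iff.2 h]
  rw [hwave h.le, mul_zero, add_zero]
  rw [abs_of_nonneg (sub_nonneg.2 hp)] at h
  refine mul_nonpos_of_nonneg_of_nonpos
    (mul_nonneg two_pos.le (mul_nonneg (sq_nonneg _) (expNegInvGlue.nonneg _))) (sub_nonpos.2 ?_)
  refine two_mul_sum_mul_le _ _ _ ((norm_nonneg _).trans_lt h) ?_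
  rw [OrthonormalBasis.sum_sq_inner_left]
  exact pow_le_pow_left₀ (norm_nonneg _) h.le 2

theorem dirDeriv_time_eq_zero_of_weightedEnergyDiv_eq_zero (hZ : ContDiff ℝ 2 Z) {s : ℝ}
    (hwave : waveOp Z (x₀, s) = 0) (hs : s ≠ T) (h : weightedEnergyDiv x₀ T Z (x₀, s) = 0) :
    dirDeriv timeDir Z (x₀, s) = 0 := by
  have hd : T - s ≠ 0 := sub_ne_zero.2 hs.symm
  have hQ : coneQuad x₀ T (x₀, s) ≠ 0 := by simpa [coneQuad] using hd
  have hW : coneWeight x₀ T (x₀, s) ≠ 0 := fun h0 => by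
    simpa [hd] using coneWeight_eq_zero_iff.1 h0
  have hdensity : energyDensity Z (x₀, s) = 0 := by
    simpa [weightedEnergyDiv_eq hZ, hwave, hQ, hW, hd] using h
  exact pow_eq_zero_iff two_ne_zero |>.1 ((add_eq_zero_iff_of_nonneg (sq_nonneg _)
    (Finset.sum_nonneg fun i _ => sq_nonneg _)).1 hdensity).1

theorem energyDensity_eq_zero_of_eventually (hZ : DifferentiableAt ℝ Z (x₀, T))
    (h0 : ∀ᶠ y in 𝓝 x₀, Z (y, T) = 0) (h1 : dirDeriv timeDir Z (x₀, T) = 0) :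
    energyDensity Z (x₀, T) = 0 := by
  have hev : (fun y => Z (y, T)) =ᶠ[𝓝 x₀] fun _ => 0 := h0
  have hspace : ∀ i, dirDeriv (spaceDir i) Z (x₀, T) = 0 := fun i => by
    rw [spaceDir, ← fderiv_slice hZ, hev.fderiv_eq, fderiv_fun_const]
    rfl
  simp [energyDensity, hspace, h1]

theorem continuous_weightedEnergyDiv (x₀ : E) (T : ℝ) (hZ : ContDiff ℝ 2 Z) :
    Continuous (weightedEnergyDiv x₀ T Z) :=
  (continuous_dirDeriv ((contDiff_coneWeight x₀ T).mul (contDiff_energyDensity hZ)) _).sub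
    (continuous_const.mul (continuous_finsetSum _ fun i _ =>
      continuous_dirDeriv ((contDiff_coneWeight x₀ T).mul (contDiff_energyFlux hZ i)) _))

theorem setIntegral_weightedEnergyDiv_eq_zero [MeasurableSpace E] [BorelSpace E] (hT : 0 ≤ T)
    (hZ : ContDiff ℝ 2 Z) (h0 : ∀ y, ‖y - x₀‖ ≤ T → Z (y, 0) = 0)
    (h1 : ∀ y, ‖y - x₀‖ ≤ T → dirDeriv timeDir Z (y, 0) = 0) :
    ∫ p in Metric.closedBall x₀ T ×ˢ Icc 0 T, weightedEnergyDiv x₀ T Z p = 0 := by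
  have hK := isCompact_closedBall x₀ T
  have hdensity := (contDiff_coneWeight x₀ T).mul (contDiff_energyDensity hZ)
  have hflux := fun i => (contDiff_coneWeight x₀ T).mul (contDiff_energyFlux hZ i)
  have hfinal : ∀ y, coneWeight x₀ T (y, T) * energyDensity Z (y, T) = 0 := fun y => by
    rw [coneWeight_eq_zero_iff.2 (by simp), zero_mul]
  have hinitial : ∀ y, coneWeight x₀ T (y, 0) * energyDensity Z (y, 0) = 0 := fun y => by
    rcases le_or_gt T ‖y - x₀‖ with hy | hy
    · rw [coneWeight_eq_zero_iff.2 (by rwa [sub_zero, abs_of_nonneg hT]), zero_mul]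
    · rw [energyDensity_eq_zero_of_eventually (hZ.differentiable two_ne_zero _) ?_ (h1 y hy.le),
        mul_zero]
      filter_upwards [Metric.isOpen_ball.mem_nhds (mem_ball_iff_norm.2 hy)] with z hz
      exact h0 z (mem_ball_iff_norm.1 hz).le
  have hlateral : ∀ i, ∀ s ∈ Icc 0 T, ∀ y ∉ Metric.closedBall x₀ T,
      coneWeight x₀ T (y, s) * energyFlux Z i (y, s) = 0 := fun i s hs y hy => by
    rw [mem_closedBall_iff_norm, not_le] at hy
    rw [coneWeight_eq_zero_iff.2 (by rw [abs_of_nonneg] <;> linarith [hs.1, hs.2]), zero_mul]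
  have htime := setIntegral_dirDeriv_time_eq_zero (μ := (volume : Measure E)) hdensity hK hT
    (fun y _ => hinitial y) fun y _ => hfinal y
  have hspace := fun i => setIntegral_dirDeriv_space_eq_zero (μ := (volume : Measure E)) (T := T)
    (hflux i) hK (hlateral i) (stdOrthonormalBasis ℝ E i)
  have hint : ∀ {F : E × ℝ → ℝ}, Continuous F →
      IntegrableOn F (Metric.closedBall x₀ T ×ˢ Icc 0 T) := fun hF =>
    hF.continuousOn.integrableOn_compact (hK.prod isCompact_Icc)
  simp only [← Measure.volume_eq_prod] at htime hspace
  have hfluxc := fun i => continuous_dirDeriv (hflux i) (spaceDir i)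
  refine (integral_sub (hint (continuous_dirDeriv hdensity _))
    (hint (continuous_const.fun_mul (continuous_finsetSum _ fun i _ => hfluxc i)))).trans ?_
  rw [htime, integral_const_mul, integral_finsetSum _ fun i _ => hint (hfluxc i)]
  simp [spaceDir, hspace]

theorem weightedEnergyDiv_eq_zero (hT : 0 ≤ T) (hZ : ContDiff ℝ 2 Z)
    (hwave : ∀ p ∈ lightCone (x₀, T), waveOp Z p = 0) (h0 : ∀ y, ‖y - x₀‖ ≤ T → Z (y, 0) = 0)
    (h1 : ∀ y, ‖y - x₀‖ ≤ T → dirDeriv timeDir Z (y, 0) = 0) :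
    EqOn (weightedEnergyDiv x₀ T Z) 0 (Metric.ball x₀ T ×ˢ Ioo 0 T) := by
  borelize E
  have hK : IsCompact (Metric.closedBall x₀ T ×ˢ Icc 0 T) :=
    (isCompact_closedBall x₀ T).prod isCompact_Icc
  have hcont := (continuous_weightedEnergyDiv x₀ T hZ).neg
  have hnonneg : ∀ p ∈ Metric.closedBall x₀ T ×ˢ Icc 0 T, 0 ≤ -weightedEnergyDiv x₀ T Z p :=
    fun p hp => neg_nonneg.2 (weightedEnergyDiv_nonpos hZ
      (fun hcone => hwave p ⟨by rw [uIcc_of_le hT]; exact hp.2, hcone⟩) hp.2.2)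
  have hae : (fun p => -weightedEnergyDiv x₀ T Z p)
      =ᵐ[volume.restrict (Metric.closedBall x₀ T ×ˢ Icc 0 T)] 0 := by
    refine (setIntegral_eq_zero_iff_of_nonneg_ae
      ((ae_restrict_iff' hK.measurableSet).2 (Eventually.of_forall hnonneg))
      (hcont.continuousOn.integrableOn_compact hK)).1 ?_
    rw [integral_neg, setIntegral_weightedEnergyDiv_eq_zero hT hZ h0 h1, neg_zero]
  intro p hp
  exact neg_eq_zero.1 (Measure.eqOn_open_of_ae_eq (ae_restrict_of_ae_restrict_of_subset
    (Set.prod_mono Metric.ball_subset_closedBall Ioo_subset_Icc_self) hae)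
    (Metric.isOpen_ball.prod isOpen_Ioo) hcont.continuousOn continuousOn_const hp)

theorem eq_zero_at_vertex_of_contDiff (hT : 0 < T) (hZ : ContDiff ℝ 2 Z)
    (hwave : ∀ p ∈ lightCone (x₀, T), waveOp Z p = 0) (h0 : ∀ y, ‖y - x₀‖ ≤ T → Z (y, 0) = 0)
    (h1 : ∀ y, ‖y - x₀‖ ≤ T → dirDeriv timeDir Z (y, 0) = 0) : Z (x₀, T) = 0 := by
  have hzero : ∀ s ∈ Ioo 0 T, dirDeriv timeDir Z (x₀, s) = 0 := fun s hs =>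
    dirDeriv_time_eq_zero_of_weightedEnergyDiv_eq_zero hZ
      (hwave _ ⟨by rw [uIcc_of_le hT.le]; exact Ioo_subset_Icc_self hs, by simp⟩) hs.2.ne
      (weightedEnergyDiv_eq_zero hT.le hZ hwave h0 h1 ⟨Metric.mem_ball_self hT, hs⟩)
  have hderiv : ∀ s, HasDerivAt (fun s => Z (x₀, s)) (dirDeriv timeDir Z (x₀, s)) s := fun s =>
    (hZ.differentiable two_ne_zero (x₀, s)).hasFDerivAt.comp_hasDerivAt s
      ((hasDerivAt_const s x₀).prodMk (hasDerivAt_id s))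
  obtain ⟨s, hs, hslope⟩ := exists_hasDerivAt_eq_slope (fun s => Z (x₀, s)) _ hT
    (fun s _ => (hderiv s).continuousAt.continuousWithinAt) (fun s _ => hderiv s)
  rw [hzero s hs, h0 x₀ (by simpa using hT.le), sub_zero, sub_zero, eq_comm,
    div_eq_zero_iff] at hslope
  exact hslope.resolve_right hT.ne'

end Energy

theorem exists_contDiff_eq_near {H : Type*} [NormedAddCommGroup H] [NormedSpace ℝ H]
    [FiniteDimensional ℝ H] {n : ℕ∞} {K D : Set H} (hK : IsCompact K) (hD : IsOpen D)
    (hKD : K ⊆ D) {Z : H → ℝ} (hZ : ContDiffOn ℝ n Z D) :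
    ∃ (Y : H → ℝ) (W : Set H), ContDiff ℝ n Y ∧ IsOpen W ∧ K ⊆ W ∧ EqOn Y Z W := by
  obtain ⟨L, hL, hKL, hLD⟩ := exists_compact_between hK hD hKD
  obtain ⟨f, hf1, hf0, -⟩ := exists_contMDiffMap_one_nhds_of_subset_interior
    (n := n) (modelWithCornersSelf ℝ H) hK.isClosed hKL
  obtain ⟨W, hW, hKW, hWf⟩ := (eventually_nhdsSet_iff_exists).1 hf1
  refine ⟨fun p => f p * Z p, W, ?_, hW, hKW, fun p hp => by simp [hWf p hp]⟩
  refine contDiff_iff_contDiffAt.2 fun p => ?_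
  by_cases hp : p ∈ D
  · exact f.contMDiff.contDiff.contDiffAt.mul (hZ.contDiffAt (hD.mem_nhds hp))
  · refine contDiffAt_const (c := (0 : ℝ)).congr_of_eventuallyEq ?_
    filter_upwards [hL.isClosed.isOpen_compl.mem_nhds fun h => hp (hLD h)] with q hq
    rw [hf0 q hq, zero_mul]

section Uniqueness

variable {E : Type*} [NormedAddCommGroup E] [InnerProductSpace ℝ E]

/-- Time reflection of the space-time `E × ℝ`. -/
def timeReflection : (E × ℝ) ≃L[ℝ] (E × ℝ) :=
  (ContinuousLinearEquiv.refl ℝ E).prodCongr (ContinuousLinearEquiv.neg ℝ)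

theorem timeReflection_apply (p : E × ℝ) : timeReflection p = (p.1, -p.2) := rfl

theorem timeReflection_timeReflection (p : E × ℝ) : timeReflection (timeReflection p) = p := by
  simp [timeReflection_apply]

theorem timeReflection_mem_lightCone {p q : E × ℝ} (hq : q ∈ lightCone (timeReflection p)) :
    timeReflection q ∈ lightCone p := by
  obtain ⟨htime, hspace⟩ := hq
  simp only [timeReflection_apply, lightCone, mem_ofPred_eq] at htime hspace ⊢
  refine ⟨?_, ?_⟩
  · simpa using neg_mem_neg.2 htime
  · rwa [neg_sub_left, abs_neg, add_comm, ← sub_neg_eq_add] at hspace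

theorem dirDeriv_comp_timeReflection (a : E × ℝ) (F : E × ℝ → ℝ) (p : E × ℝ) :
    dirDeriv a (fun q => F (timeReflection q)) p
      = dirDeriv (timeReflection a) F (timeReflection p) :=
  DFunLike.congr_fun (timeReflection (E := E)).comp_right_fderiv a

theorem dirDeriv_timeReflection_timeDir (F : E × ℝ → ℝ) (p : E × ℝ) :
    dirDeriv (timeReflection timeDir) F p = -dirDeriv timeDir F p := by
  simp [dirDeriv, timeReflection_apply, timeDir, ← map_neg]

variable [FiniteDimensional ℝ E] {Z : E × ℝ → ℝ} {D : Set (E × ℝ)} {p : E × ℝ}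

theorem waveOp_comp_timeReflection (F : E × ℝ → ℝ) (p : E × ℝ) :
    waveOp (fun q => F (timeReflection q)) p = waveOp F (timeReflection p) := by
  have htime : dirDeriv (timeReflection timeDir) (dirDeriv (timeReflection timeDir) F)
      (timeReflection p) = dirDeriv timeDir (dirDeriv timeDir F) (timeReflection p) := by
    rw [dirDeriv_timeReflection_timeDir, funext (dirDeriv_timeReflection_timeDir F), dirDeriv,
      fderiv_fun_neg, neg_apply, neg_neg, dirDeriv]
  have hspace : ∀ i, timeReflection (spaceDir (E := E) i) = spaceDir i := fun i => by
    simp [timeReflection_apply, spaceDir]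
  have hcomp : ∀ (a : E × ℝ) (G : E × ℝ → ℝ), dirDeriv a (fun q => G (timeReflection q))
      = fun q => dirDeriv (timeReflection a) G (timeReflection q) := fun a G =>
    funext (dirDeriv_comp_timeReflection a G)
  simp only [waveOp, hcomp, htime, hspace]

theorem eq_zero_of_waveOp_eq_zero_of_time_pos (hD : IsOpen D) (hZ : ContDiffOn ℝ 2 Z D)
    (hwave : ∀ q ∈ D, waveOp Z q = 0) (h0 : ∀ y, (y, (0 : ℝ)) ∈ D → Z (y, 0) = 0)
    (h1 : ∀ y, (y, (0 : ℝ)) ∈ D → dirDeriv timeDir Z (y, 0) = 0) (hp : lightCone p ⊆ D)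
    (hpos : 0 < p.2) : Z p = 0 := by
  obtain ⟨Y, W, hY, hW, hpW, hYZ⟩ :=
    exists_contDiff_eq_near (n := 2) (isCompact_lightCone p) hD hp hZ
  have hbase : ∀ y, ‖y - p.1‖ ≤ p.2 → (y, (0 : ℝ)) ∈ lightCone p := fun y hy =>
    ⟨left_mem_uIcc, by simpa [abs_of_pos hpos] using hy⟩
  rw [← hYZ (hpW (self_mem_lightCone p))]
  refine eq_zero_at_vertex_of_contDiff hpos hY (fun q hq => ?_) (fun y hy => ?_) fun y hy => ?_
  · rw [eqOn_waveOp hW hYZ (hpW hq), hwave q (hp hq)]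
  · rw [hYZ (hpW (hbase y hy)), h0 y (hp (hbase y hy))]
  · rw [eqOn_dirDeriv hW hYZ _ (hpW (hbase y hy)), h1 y (hp (hbase y hy))]

theorem eq_zero_of_waveOp_eq_zero (hD : IsOpen D) (hZ : ContDiffOn ℝ 2 Z D)
    (hwave : ∀ q ∈ D, waveOp Z q = 0) (h0 : ∀ y, (y, (0 : ℝ)) ∈ D → Z (y, 0) = 0)
    (h1 : ∀ y, (y, (0 : ℝ)) ∈ D → dirDeriv timeDir Z (y, 0) = 0) (hp : lightCone p ⊆ D) :
    Z p = 0 := by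
  rcases lt_trichotomy p.2 0 with hneg | hzero | hpos
  · have hreflect : Z p = Z (timeReflection (timeReflection p)) := by
      rw [timeReflection_timeReflection]
    rw [hreflect]
    refine eq_zero_of_waveOp_eq_zero_of_time_pos (D := timeReflection ⁻¹' D)
      (Z := fun q => Z (timeReflection q)) (hD.preimage timeReflection.continuous)
      (hZ.comp (timeReflection (E := E)).contDiff.contDiffOn fun q hq => hq)
      (fun q hq => by rw [waveOp_comp_timeReflection, hwave _ hq])
      (fun y hy => ?_) (fun y hy => ?_) (fun q hq => hp (timeReflection_mem_lightCone hq))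
      (neg_pos.2 hneg)
    · simpa [timeReflection_apply] using h0 y (by simpa [timeReflection_apply] using hy)
    · rw [dirDeriv_comp_timeReflection, dirDeriv_timeReflection_timeDir]
      simpa [timeReflection_apply] using h1 y (by simpa [timeReflection_apply] using hy)
  · obtain ⟨y, t⟩ := p
    obtain rfl : t = 0 := hzero
    exact h0 y (hp (self_mem_lightCone _))
  · exact eq_zero_of_waveOp_eq_zero_of_time_pos hD hZ hwave h0 h1 hp hpos

end Uniqueness

section PositivityDomain

variable {E : Type*} [NormedAddCommGroup E] {V : E × ℝ → ℝ} {p : E × ℝ}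

/-- The points whose solid light cone lies in `{V > 0}`. -/
def positivityDomain (V : E × ℝ → ℝ) : Set (E × ℝ) := {p | lightCone p ⊆ {q | 0 < V q}}

theorem pos_of_mem_positivityDomain (hp : p ∈ positivityDomain V) : 0 < V p :=
  hp (self_mem_lightCone p)

theorem mem_positivityDomain_time_zero {x : E} :
    (x, (0 : ℝ)) ∈ positivityDomain V ↔ 0 < V (x, 0) := by
  simp [positivityDomain, lightCone_time_zero]

theorem lightCone_subset_positivityDomain (hp : p ∈ positivityDomain V) :
    lightCone p ⊆ positivityDomain V := fun _ hq => (lightCone_subset_lightCone hq).trans hp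

theorem isOpen_positivityDomain [NormedSpace ℝ E] [ProperSpace E] (hV : Continuous V) :
    IsOpen (positivityDomain V) :=
  isOpen_setOf_lightCone_subset (isOpen_lt continuous_const hV)

end PositivityDomain

section MaximalSolution

variable {u₀ u₁ : E3 → ℝ} {D : Set (E3 × ℝ)} {u : E3 → ℝ → ℝ} {V : E3 × ℝ → ℝ}

theorem lightConeClosed_iff : LightConeClosed D ↔ ∀ p ∈ D, lightCone p ⊆ D :=
  ⟨fun h p hp q hq => h p.1 p.2 hp q.1 q.2 hq.1 hq.2,
    fun h x t hp y s hs hy => h (x, t) hp (show (y, s) ∈ lightCone (x, t) from ⟨hs, hy⟩)⟩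

theorem contDiffOn_neg_log {n : WithTop ℕ∞} (hV : ContDiff ℝ n V) :
    ContDiffOn ℝ n (fun p => -Real.log (V p)) (positivityDomain V) :=
  (hV.contDiffOn.log fun _ hp => (pos_of_mem_positivityDomain hp).ne').neg

theorem isClassicalSolution_neg_log (hV : ContDiff ℝ 2 V) (hwave : ∀ p, waveOp V p = 0)
    (h0 : ∀ x, V (x, 0) = Real.exp (-u₀ x))
    (h1 : ∀ x, dirDeriv timeDir V (x, 0) = -u₁ x * Real.exp (-u₀ x)) :
    IsClassicalSolution u₀ u₁ (positivityDomain V) fun x t => -Real.log (V (x, t)) := by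
  have hD := isOpen_positivityDomain hV.continuous
  have hU := contDiffOn_neg_log hV
  have hinit : ∀ x : E3, (x, (0 : ℝ)) ∈ positivityDomain V := fun x =>
    mem_positivityDomain_time_zero.2 (by rw [h0]; exact Real.exp_pos _)
  refine ⟨hD, hinit, lightConeClosed_iff.2 fun _ => lightCone_subset_positivityDomain, hU,
    fun x t hp => ?_, fun x => by simp [h0], fun x => ?_⟩
  · exact (equation_iff_waveOp_eq_nullForm hD hU hp).2 (waveOp_neg_log hD hV.contDiffOn
      (fun _ => pos_of_mem_positivityDomain) hp (hwave _))
  · rw [deriv_slice (U := fun p => -Real.log (V p))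
        (differentiableAt_of_contDiffOn hD hU two_ne_zero (hinit x)),
      dirDeriv_comp (f := fun s => -Real.log s) (hV.differentiable two_ne_zero _)
        (Real.hasDerivAt_log (by rw [h0]; exact (Real.exp_pos _).ne')).neg, h1, h0]
    field_simp [(Real.exp_pos (-u₀ x)).ne']

theorem IsClassicalSolution.exp_neg_eq (h : IsClassicalSolution u₀ u₁ D u) (hV : ContDiff ℝ 2 V)
    (hwave : ∀ p, waveOp V p = 0) (h0 : ∀ x, V (x, 0) = Real.exp (-u₀ x))
    (h1 : ∀ x, dirDeriv timeDir V (x, 0) = -u₁ x * Real.exp (-u₀ x)) {p : E3 × ℝ} (hp : p ∈ D) :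
    Real.exp (-u p.1 p.2) = V p := by
  have hU : ContDiffOn ℝ 2 (fun q : E3 × ℝ => u q.1 q.2) D := h.contDiffOn
  have hexp : ContDiffOn ℝ 2 (fun q : E3 × ℝ => Real.exp (-u q.1 q.2)) D := hU.neg.exp
  refine sub_eq_zero.1 (eq_zero_of_waveOp_eq_zero (Z := fun q => Real.exp (-u q.1 q.2) - V q)
    h.isOpen (hexp.sub hV.contDiffOn) (fun q hq => ?_) (fun y _ => ?_) (fun y hy => ?_)
    (lightConeClosed_iff.1 h.lightConeClosed p hp))
  · rw [waveOp_sub h.isOpen hexp hV.contDiffOn hq, hwave, sub_zero]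
    exact waveOp_exp_neg h.isOpen hU hq
      ((equation_iff_waveOp_eq_nullForm h.isOpen hU hq).1 (h.equation q.1 q.2 hq))
  · simp [h.initial_value, h0]
  · have hd := differentiableAt_of_contDiffOn h.isOpen hU two_ne_zero hy
    have hderiv : HasDerivAt (fun s => Real.exp (-s)) (-Real.exp (-u y 0)) (u y 0) := by
      simpa using (hasDerivAt_neg (u y 0)).exp
    rw [dirDeriv_sub (differentiableAt_of_contDiffOn h.isOpen hexp two_ne_zero hy)
      (hV.differentiable two_ne_zero _), dirDeriv_comp (f := fun s => Real.exp (-s)) hd hderiv, h1,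
      ← deriv_slice hd, h.initial_velocity, h.initial_value]
    ring

theorem isMaximalSolution_neg_log (hV : ContDiff ℝ 2 V) (hwave : ∀ p, waveOp V p = 0)
    (h0 : ∀ x, V (x, 0) = Real.exp (-u₀ x))
    (h1 : ∀ x, dirDeriv timeDir V (x, 0) = -u₁ x * Real.exp (-u₀ x)) :
    IsMaximalSolution u₀ u₁ (positivityDomain V) fun x t => -Real.log (V (x, t)) := by
  refine ⟨isClassicalSolution_neg_log hV hwave h0 h1, fun D' u' h' => ?_⟩
  have hexp : ∀ p ∈ D', Real.exp (-u' p.1 p.2) = V p := fun p hp =>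
    h'.exp_neg_eq hV hwave h0 h1 hp
  refine ⟨fun p hp q hq => ?_, fun x t hp => ?_⟩
  · rw [mem_ofPred_eq, ← hexp q (lightConeClosed_iff.1 h'.lightConeClosed p hp hq)]
    exact Real.exp_pos _
  · change u' x t = -Real.log (V (x, t))
    rw [← hexp _ hp, Real.log_exp, neg_neg]

end MaximalSolution

section Apex

theorem exists_first_zero {f : ℝ → ℝ} {a b : ℝ} (hf : Continuous f) (hab : a ≤ b) (ha : 0 < f a)
    (hb : f b ≤ 0) : ∃ c ∈ Ioc a b, f c = 0 ∧ ∀ s ∈ Ico a c, 0 < f s := by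
  obtain ⟨c, ⟨⟨hac, hcb⟩, hc⟩, hmin⟩ := (isCompact_Icc.inter_right
    (isClosed_le hf continuous_const)).exists_isLeast ⟨b, right_mem_Icc.2 hab, hb⟩
  have hac' : a < c := hac.lt_of_ne fun h => absurd (h ▸ ha) (not_lt.2 hc)
  have hpos : ∀ s ∈ Ico a c, 0 < f s := fun s hs => not_le.1 fun h =>
    absurd (hmin ⟨⟨hs.1, hs.2.le.trans hcb⟩, h⟩) (not_le.2 hs.2)
  refine ⟨c, ⟨hac', hcb⟩, le_antisymm hc ?_, hpos⟩
  refine ge_of_tendsto (hf.continuousWithinAt (s := Iio c)) ?_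
  filter_upwards [Ioo_mem_nhdsLT hac'] with s hs using (hpos s ⟨hs.1.le, hs.2⟩).le

variable {q : ℝ → ℝ} {t₀ : ℝ}

theorem weightedMean_pos_iff (hq : Continuous q) {r : ℝ} (hr : 0 < r) (t : ℝ) :
    0 < weightedMean 0 q r t ↔
      (∫ s in (0 : ℝ)..(t - r), q s) < ∫ s in (0 : ℝ)..(t + r), q s := by
  rw [← mul_pos_iff_of_pos_left hr, radius_mul_weightedMean hq, sub_pos]

theorem strictMonoOn_primitive (hq : Continuous q) (hpos : ∀ s ∈ Ico 0 t₀, 0 < q s) :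
    StrictMonoOn (fun b => ∫ s in (0 : ℝ)..b, q s) (Icc 0 t₀) := by
  refine strictMonoOn_of_deriv_pos (convex_Icc 0 t₀)
    (intervalIntegral.continuous_primitive (fun a b => hq.intervalIntegrable a b) 0).continuousOn
    fun s hs => ?_
  rw [interior_Icc] at hs
  rw [hq.deriv_integral]
  exact hpos s ⟨hs.1.le, hs.2⟩

theorem primitive_neg_lt (hq : Continuous q) (hinit : ∀ r, 0 < r → 0 < weightedMean 0 q r 0)
    {r : ℝ} (hr : 0 < r) : (∫ s in (0 : ℝ)..(-r), q s) < ∫ s in (0 : ℝ)..r, q s := by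
  simpa using (weightedMean_pos_iff hq hr 0).1 (hinit r hr)

theorem weightedMean_pos_of_add_lt (hq : Continuous q) (hpos : ∀ s ∈ Ico 0 t₀, 0 < q s)
    (hinit : ∀ r, 0 < r → 0 < weightedMean 0 q r 0) {r s : ℝ} (hs : 0 ≤ s) (hr : 0 ≤ r)
    (hsr : s + r < t₀) : 0 < weightedMean 0 q r s := by
  rcases hr.eq_or_lt with rfl | hr
  · rw [weightedMean_radius_zero]
    exact mul_pos two_pos (hpos s ⟨hs, by linarith⟩)
  have hmono := strictMonoOn_primitive hq hpos
  rw [weightedMean_pos_iff hq hr]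
  rcases le_or_gt 0 (s - r) with h | h
  · exact hmono ⟨h, by linarith⟩ ⟨by linarith, hsr.le⟩ (by linarith)
  · have hneg := primitive_neg_lt hq hinit (r := r - s) (by linarith)
    rw [neg_sub] at hneg
    exact hneg.trans_le (hmono.monotoneOn ⟨by linarith, by linarith⟩ ⟨by linarith, hsr.le⟩
      (by linarith))

theorem weightedMean_pos_of_add_le (hq : Continuous q) (hpos : ∀ s ∈ Ico 0 t₀, 0 < q s)
    (hinit : ∀ r, 0 < r → 0 < weightedMean 0 q r 0) {ε t R r s : ℝ} (hε : 3 * ε ≤ t₀)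
    (hnear : ∀ a b, |a - t₀| < 3 * ε → |b - t₀| < ε →
      (∫ τ in (0 : ℝ)..(-a), q τ) < ∫ τ in (0 : ℝ)..b, q τ)
    (ht : t ∈ Ioo (t₀ - ε) t₀) (hR : R < ε) (hmean : ∀ ρ ∈ Icc 0 R, 0 < weightedMean 0 q ρ t)
    (hs : s ∈ Icc 0 t) (hr : 0 ≤ r) (hsr : s + r ≤ t + R) : 0 < weightedMean 0 q r s := by
  obtain ⟨hs0, hst⟩ := hs
  obtain ⟨htε, htt₀⟩ := ht
  rcases lt_or_ge (s + r) t₀ with hlt | hge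
  · exact weightedMean_pos_of_add_lt hq hpos hinit hs0 hr hlt
  have hmono := (strictMonoOn_primitive hq hpos).monotoneOn
  rw [weightedMean_pos_iff hq (by linarith)]
  have hreflect : (∫ τ in (0 : ℝ)..(2 * t - (s + r)), q τ) < ∫ τ in (0 : ℝ)..(s + r), q τ := by
    have h := (weightedMean_pos_iff hq (r := s + r - t) (by linarith) t).1
      (hmean _ ⟨by linarith, by linarith⟩)
    rwa [add_sub_cancel, show t - (s + r - t) = 2 * t - (s + r) by ring] at h
  have hmem : 2 * t - (s + r) ∈ Icc 0 t₀ := ⟨by linarith, by linarith⟩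
  rcases le_or_gt 0 (s - r) with h | h
  · exact (hmono ⟨h, by linarith⟩ hmem (by linarith)).trans_lt hreflect
  · rw [← neg_sub r s]
    rcases le_or_gt r t with hrt | hrt
    · exact ((primitive_neg_lt hq hinit (by linarith)).trans_le
        (hmono ⟨by linarith, by linarith⟩ hmem (by linarith))).trans hreflect
    · exact hnear _ _ (abs_lt.2 ⟨by linarith, by linarith⟩) (abs_lt.2 ⟨by linarith, by linarith⟩)

theorem eventually_weightedMean_pos_of_add_le (hq : Continuous q) (ht₀ : 0 < t₀)
    (hpos : ∀ s ∈ Ico 0 t₀, 0 < q s) (hinit : ∀ r, 0 < r → 0 < weightedMean 0 q r 0) :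
    ∀ᶠ ε in 𝓝[>] (0 : ℝ), ∀ t ∈ Ioo (t₀ - ε) t₀, ∀ R < ε,
      (∀ ρ ∈ Icc 0 R, 0 < weightedMean 0 q ρ t) →
      ∀ s ∈ Icc 0 t, ∀ r, 0 ≤ r → s + r ≤ t + R → 0 < weightedMean 0 q r s := by
  have hprim : Continuous fun b => ∫ τ in (0 : ℝ)..b, q τ :=
    intervalIntegral.continuous_primitive (fun a b => hq.intervalIntegrable a b) 0
  have hnhds : ∀ᶠ z : ℝ × ℝ in 𝓝 (t₀, t₀),
      (∫ τ in (0 : ℝ)..(-z.1), q τ) < ∫ τ in (0 : ℝ)..z.2, q τ :=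
    (isOpen_lt (hprim.comp continuous_fst.neg) (hprim.comp continuous_snd)).mem_nhds
      (primitive_neg_lt hq hinit ht₀)
  obtain ⟨e, he, hball⟩ := Metric.eventually_nhds_iff.1 hnhds
  filter_upwards [Ioo_mem_nhdsGT (lt_min (by positivity : 0 < e / 3) (by positivity : 0 < t₀ / 3))]
    with ε hε t ht R hR hmean s hs r hr hsr
  obtain ⟨hεe, hεt⟩ := lt_min_iff.1 hε.2
  refine weightedMean_pos_of_add_le hq hpos hinit (by linarith) (fun a b ha hb => ?_) ht hR hmean
    hs hr hsr
  exact hball (y := (a, b)) (max_lt (ha.trans (by linarith)) (hb.trans (by linarith [hε.1])))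

variable {E : Type*} [NormedAddCommGroup E]

theorem mem_positivityDomain_radialMean {k : ℕ} {x : E} {t : ℝ} (ht : 0 ≤ t)
    (h : ∀ s ∈ Icc 0 t, ∀ r, 0 ≤ r → s + r ≤ t + ‖x‖ → 0 < weightedMean k q r s) :
    (x, t) ∈ positivityDomain (radialMean k q) := by
  rintro ⟨y, s⟩ ⟨hs, hy⟩
  rw [uIcc_of_le ht] at hs
  rw [abs_of_nonneg (sub_nonneg.2 hs.2)] at hy
  exact h s hs ‖y‖ (norm_nonneg y) (by linarith [norm_sub_norm_le y x])

theorem axis_mem_positivityDomain (hq : Continuous q) (hpos : ∀ s ∈ Ico 0 t₀, 0 < q s)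
    (hinit : ∀ r, 0 < r → 0 < weightedMean 0 q r 0) {t : ℝ} (ht : t ∈ Ico 0 t₀) :
    ((0 : E), t) ∈ positivityDomain (radialMean 0 q) :=
  mem_positivityDomain_radialMean ht.1 fun s hs r hr hsr =>
    weightedMean_pos_of_add_lt hq hpos hinit hs.1 hr (by linarith [norm_zero (E := E), ht.2])

end Apex

section EssentialSupremum

theorem enorm_le_eLpNorm_top_restrict {X F : Type*} [TopologicalSpace X] [MeasurableSpace X]
    [OpensMeasurableSpace X] [NormedAddCommGroup F] (μ : Measure X) [μ.IsOpenPosMeasure]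
    {f : X → F} {S : Set X} {x₀ : X} (hf : ContinuousAt f x₀) (hS : S ∈ 𝓝 x₀) :
    ‖f x₀‖ₑ ≤ eLpNorm f ⊤ (μ.restrict S) := by
  by_contra! hlt
  have hnhds : interior S ∩ {x | eLpNorm f ⊤ (μ.restrict S) < ‖f x‖ₑ} ∈ 𝓝 x₀ :=
    inter_mem (interior_mem_nhds.2 hS) (hf.enorm.eventually (lt_mem_nhds hlt))
  have hae : ∀ᵐ x ∂μ, x ∈ interior S → ‖f x‖ₑ ≤ eLpNorm f ⊤ (μ.restrict S) :=
    (ae_restrict_iff' isOpen_interior.measurableSet).1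
      (ae_restrict_of_ae_restrict_of_subset interior_subset (by
        simpa only [eLpNorm_exponent_top] using ae_le_eLpNormEssSup (f := f)))
  refine (Measure.measure_pos_of_mem_nhds μ hnhds).ne'
    (measure_mono_null (fun x hx => ?_) (ae_iff.1 hae))
  exact fun h => absurd (h hx.1) (not_le.2 hx.2)

theorem ofReal_sq_mul_measureReal_le_lintegral {X : Type*} [MeasurableSpace X] {μ : Measure X}
    {A S : Set X} (hA : MeasurableSet A) (hμA : μ A ≠ ⊤) (hAS : A ⊆ S) {f : X → ℝ} {m : ℝ}
    (hm : 0 ≤ m) (hf : ∀ x ∈ A, m ≤ f x) :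
    ENNReal.ofReal (m ^ 2 * μ.real A) ≤ ∫⁻ x in S, ‖f x‖ₑ ^ 2 ∂μ := by
  calc ENNReal.ofReal (m ^ 2 * μ.real A) = ∫⁻ _ in A, ENNReal.ofReal m ^ 2 ∂μ := by
        rw [setLIntegral_const, ENNReal.ofReal_mul (sq_nonneg m), ofReal_measureReal hμA,
          ENNReal.ofReal_pow hm]
    _ ≤ ∫⁻ x in A, ‖f x‖ₑ ^ 2 ∂μ := setLIntegral_mono' hA fun x hx => by
        rw [Real.enorm_eq_ofReal_abs]
        gcongr
        exact (hf x hx).trans (le_abs_self _)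
    _ ≤ ∫⁻ x in S, ‖f x‖ₑ ^ 2 ∂μ := lintegral_mono_set hAS

end EssentialSupremum

section Orthogonality

variable {E : Type*} [NormedAddCommGroup E] [InnerProductSpace ℝ E]

theorem half_norm_sq_le_norm_sub_sq {u v : E} (h : |inner ℝ u v| ≤ ‖u‖ * ‖v‖ / 2) :
    ‖u‖ ^ 2 / 2 ≤ ‖u - v‖ ^ 2 := by
  rw [norm_sub_sq_real]
  nlinarith [le_abs_self (inner ℝ u v), sq_nonneg (‖u‖ - ‖v‖), sq_nonneg ‖v‖]

theorem exists_norm_eq_one_inner_eq_zero [FiniteDimensional ℝ E]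
    (hE : 2 ≤ Module.finrank ℝ E) (x : E) : ∃ e : E, ‖e‖ = 1 ∧ inner ℝ x e = 0 := by
  have hne : (ℝ ∙ x)ᗮ ≠ ⊥ := fun h => by
    have hspan := finrank_span_le_card (R := ℝ) ({x} : Set E)
    rw [Submodule.orthogonal_eq_bot_iff.1 h, finrank_top, toFinset_card, Fintype.card_unique]
      at hspan
    lia
  obtain ⟨w, hw, hw0⟩ := Submodule.exists_mem_ne_zero_of_ne_bot hne
  refine ⟨‖w‖⁻¹ • w, norm_smul_inv_norm hw0, ?_⟩
  rw [inner_smul_right, Submodule.mem_orthogonal_singleton_iff_inner_right.1 hw, mul_zero]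

theorem exists_ball_abs_inner_le [FiniteDimensional ℝ E] (hE : 2 ≤ Module.finrank ℝ E) (x : E) :
    ∃ z : E, ∀ y ∈ Metric.ball z (‖x‖ / 8),
      0 < ‖y‖ ∧ ‖y‖ < ‖x‖ ∧ |inner ℝ x y| ≤ ‖x‖ * ‖y‖ / 2 := by
  obtain ⟨e, he, hxe⟩ := exists_norm_eq_one_inner_eq_zero hE x
  refine ⟨(‖x‖ / 2) • e, fun y hy => ?_⟩
  have hz : ‖(‖x‖ / 2) • e‖ = ‖x‖ / 2 := by
    rw [norm_smul, he, mul_one, Real.norm_of_nonneg (by positivity)]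
  have hyz := mem_ball_iff_norm.1 hy
  have hupper := norm_sub_norm_le y ((‖x‖ / 2) • e)
  have hlower := norm_sub_norm_le ((‖x‖ / 2) • e) y
  rw [norm_sub_rev] at hlower
  refine ⟨by linarith [norm_nonneg (y - (‖x‖ / 2) • e)], by linarith [norm_nonneg y], ?_⟩
  calc |inner ℝ x y| = |inner ℝ x (y - (‖x‖ / 2) • e)| := by
        rw [inner_sub_right, inner_smul_right, hxe, mul_zero, sub_zero]
    _ ≤ ‖x‖ * ‖y - (‖x‖ / 2) • e‖ := abs_real_inner_le_norm _ _
    _ ≤ ‖x‖ * (‖y‖ / 2) := by gcongr; linarith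
    _ = ‖x‖ * ‖y‖ / 2 := by ring

theorem abs_inner_smul_smul_le {x y : E} (h : |inner ℝ x y| ≤ ‖x‖ * ‖y‖ / 2) (a b : ℝ) :
    |inner ℝ (a • x) (b • y)| ≤ ‖a • x‖ * ‖b • y‖ / 2 := by
  rw [real_inner_smul_left, real_inner_smul_right, abs_mul, abs_mul, norm_smul, norm_smul,
    Real.norm_eq_abs, Real.norm_eq_abs]
  calc |a| * (|b| * |inner ℝ x y|) ≤ |a| * (|b| * (‖x‖ * ‖y‖ / 2)) := by gcongr
    _ = |a| * ‖x‖ * (|b| * ‖y‖) / 2 := by ring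

theorem ofReal_le_enorm_sub_sq_div {x y u v : E} (hyx : ‖y‖ < ‖x‖)
    (huv : |inner ℝ u v| ≤ ‖u‖ * ‖v‖ / 2) (m : ℕ) :
    ENNReal.ofReal (‖u‖ ^ 2 / 2 / (2 * ‖x‖) ^ m) ≤ ‖u - v‖ₑ ^ 2 / ‖x - y‖ₑ ^ m := by
  have hpos : 0 < ‖x - y‖ := by linarith [norm_sub_norm_le x y]
  have hle : ‖x - y‖ ≤ 2 * ‖x‖ := by linarith [norm_sub_le x y]
  rw [← ofReal_norm, ← ofReal_norm, ← ENNReal.ofReal_pow (norm_nonneg _),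
    ← ENNReal.ofReal_pow (norm_nonneg _), ← ENNReal.ofReal_div_of_pos (by positivity)]
  have hhalf := half_norm_sq_le_norm_sub_sq huv
  gcongr

theorem hasGradientAt_comp_norm [CompleteSpace E] {F : ℝ → ℝ} {F' : ℝ} {x : E} (hx : x ≠ 0)
    (hF : HasDerivAt F F' ‖x‖) : HasGradientAt (fun y : E => F ‖y‖) ((F' / ‖x‖) • x) x := by
  rw [hasGradientAt_iff_hasFDerivAt]
  refine (hF.comp_hasFDerivAt x (hasFDerivAt_norm hx)).congr_fderiv ?_
  ext y
  simp [div_eq_mul_inv, mul_assoc]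

end Orthogonality

section Gagliardo

variable {E : Type*} [NormedAddCommGroup E] [InnerProductSpace ℝ E] [FiniteDimensional ℝ E]
  [MeasurableSpace E] [BorelSpace E]

/-- The square of the Gagliardo seminorm of `H^{1/2}(S)`, with values in `[0, ∞]`; the exponent of
the kernel is `n + 2 · (1/2)`, where `n` is the dimension. -/
noncomputable def gagliardoHalf (S : Set E) (g : E → E) : ℝ≥0∞ :=
  ∫⁻ x in S, ∫⁻ y in S, ‖g x - g y‖ₑ ^ 2 / ‖x - y‖ₑ ^ (Module.finrank ℝ E + 1)

variable {S : Set E} {g : E → E} {φ F : ℝ → ℝ} {ρ a b : ℝ}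

theorem integral_indicator_Ioc_norm [Nontrivial E] (ha : 0 ≤ a) (hab : a ≤ b) (h : ℝ → ℝ) :
    ∫ x : E, (Ioc a b).indicator h ‖x‖
      = Module.finrank ℝ E * volume.real (Metric.ball (0 : E) 1) *
        ∫ r in a..b, r ^ (Module.finrank ℝ E - 1) * h r := by
  have hindicator : ∀ r : ℝ, r ^ (Module.finrank ℝ E - 1) • (Ioc a b).indicator h r
      = (Ioc a b).indicator (fun r => r ^ (Module.finrank ℝ E - 1) * h r) r := fun r =>
    (indicator_smul_apply (Ioc a b) (fun r => r ^ (Module.finrank ℝ E - 1)) h r).symm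
  rw [integral_fun_norm_addHaar, intervalIntegral.integral_of_le hab, nsmul_eq_mul, smul_eq_mul,
    ← mul_assoc]
  simp only [hindicator]
  rw [setIntegral_indicator measurableSet_Ioc,
    inter_eq_right.2 (show Ioc a b ⊆ Ioi 0 from fun r hr => ha.trans_lt hr.1)]

theorem ofReal_integral_indicator_Ioc_norm_le_lintegral {K : E → ℝ≥0∞} {h : ℝ → ℝ}
    (hK : ∀ x : E, ‖x‖ ∈ Ioc a b → ‖h ‖x‖‖ₑ ≤ K x) :
    ENNReal.ofReal (∫ x : E, (Ioc a b).indicator h ‖x‖) ≤ ∫⁻ x in {x | ‖x‖ ∈ Ioc a b}, K x := by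
  calc _ ≤ ‖∫ x : E, (Ioc a b).indicator h ‖x‖‖ₑ := by
        rw [Real.enorm_eq_ofReal_abs]
        exact ENNReal.ofReal_le_ofReal (le_abs_self _)
    _ ≤ ∫⁻ x : E, ‖(Ioc a b).indicator h ‖x‖‖ₑ := enorm_integral_le_lintegral_enorm _
    _ ≤ ∫⁻ x : E, {x : E | ‖x‖ ∈ Ioc a b}.indicator K x := lintegral_mono fun x => by
        by_cases hx : ‖x‖ ∈ Ioc a b
        · rw [indicator_of_mem hx, indicator_of_mem (s := {x : E | ‖x‖ ∈ Ioc a b}) hx]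
          exact hK x hx
        · simp [indicator_of_notMem hx]
    _ = _ := lintegral_indicator (measurableSet_Ioc.preimage measurable_norm) _

theorem ofReal_le_lintegral_radialField (hE : 2 ≤ Module.finrank ℝ E) (hS : Metric.ball 0 ρ ⊆ S)
    (hg : ∀ x ∈ Metric.ball 0 ρ, x ≠ 0 → g x = (φ ‖x‖ / ‖x‖) • x) {x : E}
    (hx : x ∈ Metric.ball 0 ρ) (hx0 : x ≠ 0) :
    ENNReal.ofReal (volume.real (Metric.ball (0 : E) 1) / (4 * 16 ^ Module.finrank ℝ E) *
        (φ ‖x‖ ^ 2 / ‖x‖))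
      ≤ ∫⁻ y in S, ‖g x - g y‖ₑ ^ 2 / ‖x - y‖ₑ ^ (Module.finrank ℝ E + 1) := by
  have : Nontrivial E := Module.nontrivial_of_finrank_pos (R := ℝ) (by lia)
  have hpos : 0 < ‖x‖ := norm_pos_iff.2 hx0
  obtain ⟨z, hz⟩ := exists_ball_abs_inner_le hE x
  have hball : ∀ y ∈ Metric.ball z (‖x‖ / 8), y ∈ Metric.ball 0 ρ := fun y hy =>
    mem_ball_zero_iff.2 ((hz y hy).2.1.trans (mem_ball_zero_iff.1 hx))
  have hgx : ‖g x‖ ^ 2 = φ ‖x‖ ^ 2 := by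
    rw [hg x hx hx0, norm_smul, norm_div, norm_norm, div_mul_cancel₀ _ hpos.ne', Real.norm_eq_abs,
      sq_abs]
  calc _ = ∫⁻ _ in Metric.ball z (‖x‖ / 8),
          ENNReal.ofReal (‖g x‖ ^ 2 / 2 / (2 * ‖x‖) ^ (Module.finrank ℝ E + 1)) := by
        rw [setLIntegral_const, Measure.addHaar_ball _ z (by positivity),
          ← ofReal_measureReal measure_ball_lt_top.ne, ← ENNReal.ofReal_mul (by positivity),
          ← ENNReal.ofReal_mul (by positivity), hgx]
        congr 1
        rw [div_pow, show (16 : ℝ) = 2 * 8 by norm_num, mul_pow, mul_pow]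
        field_simp
        ring
    _ ≤ ∫⁻ y in Metric.ball z (‖x‖ / 8),
          ‖g x - g y‖ₑ ^ 2 / ‖x - y‖ₑ ^ (Module.finrank ℝ E + 1) := by
        refine setLIntegral_mono' measurableSet_ball fun y hy => ?_
        obtain ⟨hy0, hyx, hinner⟩ := hz y hy
        refine ofReal_le_enorm_sub_sq_div hyx ?_ _
        rw [hg x hx hx0, hg y (hball y hy) (norm_pos_iff.1 hy0)]
        exact abs_inner_smul_smul_le hinner _ _
    _ ≤ _ := lintegral_mono_set fun y hy => hS (hball y hy)

/-- The constant in the lower bound for the seminorm of a radial field. -/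
noncomputable def gagliardoConst (E : Type*) [NormedAddCommGroup E] [InnerProductSpace ℝ E]
    [FiniteDimensional ℝ E] [MeasurableSpace E] [BorelSpace E] : ℝ :=
  Module.finrank ℝ E * volume.real (Metric.ball (0 : E) 1) ^ 2 / (4 * 16 ^ Module.finrank ℝ E)

theorem gagliardoConst_pos [Nontrivial E] : 0 < gagliardoConst E := by
  have hball : 0 < volume.real (Metric.ball (0 : E) 1) :=
    ENNReal.toReal_pos (Metric.measure_ball_pos _ _ one_pos).ne' measure_ball_lt_top.ne
  have hdim : 0 < Module.finrank ℝ E := Module.finrank_pos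
  unfold gagliardoConst
  positivity

theorem ofReal_integral_sq_le_gagliardoHalf (hE : 2 ≤ Module.finrank ℝ E)
    (hS : Metric.ball 0 ρ ⊆ S)
    (hg : ∀ x ∈ Metric.ball 0 ρ, x ≠ 0 → g x = (φ ‖x‖ / ‖x‖) • x)
    (ha : 0 < a) (hab : a ≤ b) (hb : b < ρ) :
    ENNReal.ofReal (gagliardoConst E * ∫ r in a..b, φ r ^ 2 * r ^ (Module.finrank ℝ E - 2))
      ≤ gagliardoHalf S g := by
  have : Nontrivial E := Module.nontrivial_of_finrank_pos (R := ℝ) (by lia)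
  have hmem : ∀ x : E, ‖x‖ ∈ Ioc a b → x ∈ Metric.ball 0 ρ := fun x hx =>
    mem_ball_zero_iff.2 (hx.2.trans_lt hb)
  set κ := volume.real (Metric.ball (0 : E) 1) / (4 * 16 ^ Module.finrank ℝ E) with hκ
  have hpow : ∀ r ∈ uIcc a b, r ^ (Module.finrank ℝ E - 1) * (κ * (φ r ^ 2 / r))
      = κ * (φ r ^ 2 * r ^ (Module.finrank ℝ E - 2)) := fun r hr => by
    have hr0 : r ≠ 0 := (ha.trans_le (uIcc_of_le hab ▸ hr).1).ne'
    rw [show Module.finrank ℝ E - 1 = Module.finrank ℝ E - 2 + 1 by lia, pow_succ]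
    field_simp
  calc _ = ENNReal.ofReal (∫ x : E, (Ioc a b).indicator (fun r => κ * (φ r ^ 2 / r)) ‖x‖) := by
        rw [integral_indicator_Ioc_norm ha.le hab, intervalIntegral.integral_congr hpow,
          intervalIntegral.integral_const_mul, gagliardoConst, hκ]
        ring_nf
    _ ≤ ∫⁻ x in {x | ‖x‖ ∈ Ioc a b}, ∫⁻ y in S,
          ‖g x - g y‖ₑ ^ 2 / ‖x - y‖ₑ ^ (Module.finrank ℝ E + 1) := by
        refine ofReal_integral_indicator_Ioc_norm_le_lintegral fun x hx => ?_
        rw [Real.enorm_of_nonneg (by positivity)]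
        exact ofReal_le_lintegral_radialField hE hS hg (hmem x hx) (norm_pos_iff.1 (ha.trans hx.1))
    _ ≤ gagliardoHalf S g := lintegral_mono_set fun x hx => hS (hmem x hx)

end Gagliardo

section Annulus

variable {E : Type*} [NormedAddCommGroup E]

/-- The shell `ε / 2 < |x| < ε`. -/
def annulus (E : Type*) [NormedAddCommGroup E] (ε : ℝ) : Set E := {x | ‖x‖ ∈ Ioo (ε / 2) ε}

theorem isOpen_annulus (ε : ℝ) : IsOpen (annulus E ε) := isOpen_Ioo.preimage continuous_norm

theorem annulus_subset_ball (ε : ℝ) : annulus E ε ⊆ Metric.ball 0 ε := fun _ hx =>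
  mem_ball_zero_iff.2 hx.2

end Annulus

section Logarithm

theorem abs_sub_le_integral_deriv_sq_mul_add_log {F : ℝ → ℝ} {a b : ℝ} (ha : 0 < a) (hab : a ≤ b)
    (hF : ∀ r ∈ Icc a b, DifferentiableAt ℝ F r) (hF' : ContinuousOn (deriv F) (Icc a b)) :
    |F b - F a| ≤ (∫ r in a..b, deriv F r ^ 2 * r) + Real.log (b / a) / 4 := by
  rw [← uIcc_of_le hab] at hF hF'
  have hpos : ∀ r ∈ uIcc a b, 0 < r := fun r hr => ha.trans_le (uIcc_of_le hab ▸ hr).1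
  have hint : IntervalIntegrable (fun r => deriv F r ^ 2 * r) volume a b :=
    ((hF'.pow 2).mul continuousOn_id).intervalIntegrable
  have hinv : IntervalIntegrable (fun r : ℝ => r⁻¹ / 4) volume a b :=
    ((continuousOn_id.inv₀ fun r hr => (hpos r hr).ne').div_const 4).intervalIntegrable
  rw [← intervalIntegral.integral_deriv_eq_sub hF hF'.intervalIntegrable]
  calc |∫ r in a..b, deriv F r| ≤ ∫ r in a..b, |deriv F r| :=
        intervalIntegral.abs_integral_le_integral_abs hab
    _ ≤ ∫ r in a..b, (deriv F r ^ 2 * r + r⁻¹ / 4) := by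
        refine intervalIntegral.integral_mono_on hab hF'.abs.intervalIntegrable (hint.add hinv)
          fun r hr => ?_
        have hr0 : 0 < r := ha.trans_le hr.1
        have hsq : deriv F r ^ 2 * r + r⁻¹ / 4 - |deriv F r|
            = r⁻¹ * (|deriv F r| * r - 1 / 2) ^ 2 := by
          rw [← sq_abs (deriv F r)]
          field_simp
          ring
        exact sub_nonneg.1 (hsq ▸ by positivity)
    _ = _ := by
        rw [intervalIntegral.integral_add hint hinv, intervalIntegral.integral_div,
          integral_inv_of_pos ha (ha.trans_le hab)]

variable {E : Type*} [NormedAddCommGroup E] [InnerProductSpace ℝ E] [FiniteDimensional ℝ E]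
  [MeasurableSpace E] [BorelSpace E] {S : Set E} {F : ℝ → ℝ} {ρ a b : ℝ}

theorem ofReal_abs_sub_le_gagliardoHalf_gradient (hE : Module.finrank ℝ E = 3)
    (hS : Metric.ball 0 ρ ⊆ S) (hF : ContDiffOn ℝ 1 F (Ioo 0 ρ)) (ha : 0 < a) (hab : a ≤ b)
    (hb : b < ρ) :
    ENNReal.ofReal (gagliardoConst E * (|F b - F a| - Real.log (b / a) / 4))
      ≤ gagliardoHalf S (gradient fun x : E => F ‖x‖) := by
  have : Nontrivial E := Module.nontrivial_of_finrank_pos (R := ℝ) (by lia)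
  have hdiff : ∀ r ∈ Ioo 0 ρ, DifferentiableAt ℝ F r := fun r hr =>
    (hF.differentiableOn one_ne_zero).differentiableAt (isOpen_Ioo.mem_nhds hr)
  have hsub : Icc a b ⊆ Ioo 0 ρ := fun r hr => ⟨ha.trans_le hr.1, hr.2.trans_lt hb⟩
  have hgrad : ∀ x ∈ Metric.ball (0 : E) ρ, x ≠ 0 →
      gradient (fun y : E => F ‖y‖) x = (deriv F ‖x‖ / ‖x‖) • x := fun x hx hx0 =>
    (hasGradientAt_comp_norm hx0
      (hdiff _ ⟨norm_pos_iff.2 hx0, mem_ball_zero_iff.1 hx⟩).hasDerivAt).gradient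
  refine le_trans (ENNReal.ofReal_le_ofReal ?_)
    (ofReal_integral_sq_le_gagliardoHalf (by lia) hS hgrad ha hab hb)
  have hlog := abs_sub_le_integral_deriv_sq_mul_add_log ha hab (fun r hr => hdiff r (hsub hr))
    ((hF.continuousOn_deriv_of_isOpen isOpen_Ioo le_rfl).mono hsub)
  simp only [hE, Nat.reduceSub, pow_one]
  exact mul_le_mul_of_nonneg_left (by linarith) gagliardoConst_pos.le

theorem gagliardoHalf_gradient_eq_top (hE : Module.finrank ℝ E = 3) (hρ : 0 < ρ)
    (hS : Metric.ball 0 ρ ⊆ S) (hF : ContDiffOn ℝ 1 F (Ioo 0 ρ))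
    (hlim : Tendsto F (𝓝[<] ρ) atTop) : gagliardoHalf S (gradient fun x : E => F ‖x‖) = ⊤ := by
  have : Nontrivial E := Module.nontrivial_of_finrank_pos (R := ℝ) (by lia)
  have hhalf : 0 < ρ / 2 := half_pos hρ
  have hlower : Tendsto (fun b => ENNReal.ofReal (gagliardoConst E *
      (|F b - F (ρ / 2)| - Real.log (ρ / (ρ / 2)) / 4))) (𝓝[<] ρ) (𝓝 ⊤) :=
    ENNReal.tendsto_ofReal_atTop.comp (.const_mul_atTop gagliardoConst_pos
      (tendsto_atTop_add_const_right _ _ (tendsto_abs_atTop_atTop.comp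
        (tendsto_atTop_add_const_right _ _ hlim))))
  refine top_le_iff.1 (le_of_tendsto hlower ?_)
  filter_upwards [Ioo_mem_nhdsLT (half_lt_self hρ)] with b hb
  refine le_trans (ENNReal.ofReal_le_ofReal ?_)
    (ofReal_abs_sub_le_gagliardoHalf_gradient hE hS hF hhalf hb.1.le hb.2)
  have hconst := (gagliardoConst_pos (E := E)).le
  have hb0 : 0 < b := hhalf.trans hb.1
  gcongr
  exact hb.2.le

theorem measure_annulus_ne_top (ε : ℝ) : volume (annulus E ε) ≠ ⊤ :=
  measure_ne_top_of_subset (annulus_subset_ball ε) measure_ball_lt_top.ne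

theorem measureReal_annulus_pos [Nontrivial E] {ε : ℝ} (hε : 0 < ε) :
    0 < volume.real (annulus E ε) := by
  obtain ⟨x, hx⟩ := exists_norm_eq E (c := 3 * ε / 4) (by positivity)
  exact ENNReal.toReal_pos ((isOpen_annulus ε).measure_pos volume
    ⟨x, by constructor <;> linarith⟩).ne' (measure_annulus_ne_top ε)

/-- Either `F` stays above `L / 8` on the whole shell, or it drops by at least `3 L / 4` between
the radius `δ` and some radius of the shell. -/
theorem le_lintegral_sq_or_le_gagliardoHalf_gradient (hE : Module.finrank ℝ E = 3) {ε δ L : ℝ}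
    (hS : Metric.ball 0 ε ⊆ S) (hF : ContDiffOn ℝ 1 F (Ioo 0 ε)) (hδ : 0 < δ) (hδε : δ < ε / 2)
    (hε : ε ≤ 1) (hLδ : L = -Real.log δ)
    (hL : 32 * gagliardoConst E / volume.real (annulus E ε) ≤ L) (hFδ : 7 / 8 * L ≤ F δ) :
    ENNReal.ofReal (gagliardoConst E / 2 * L) ≤ (∫⁻ x in S, ‖F ‖x‖‖ₑ ^ 2) ∨
      ENNReal.ofReal (gagliardoConst E / 2 * L)
        ≤ gagliardoHalf S (gradient fun x : E => F ‖x‖) := by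
  have : Nontrivial E := Module.nontrivial_of_finrank_pos (R := ℝ) (by lia)
  have hconst := gagliardoConst_pos (E := E)
  have hvol := measureReal_annulus_pos (E := E) (ε := ε) (by linarith)
  have hL0 : 0 < L := lt_of_lt_of_le (by positivity) hL
  by_cases hlarge : ∀ x ∈ annulus E ε, L / 8 ≤ F ‖x‖
  · refine .inl (le_trans (ENNReal.ofReal_le_ofReal ?_) (ofReal_sq_mul_measureReal_le_lintegral
      (isOpen_annulus ε).measurableSet (measure_annulus_ne_top ε)
      ((annulus_subset_ball ε).trans hS) (by positivity) hlarge))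
    rw [div_le_iff₀ hvol] at hL
    calc gagliardoConst E / 2 * L = 32 * gagliardoConst E * (L / 64) := by ring
      _ ≤ L * volume.real (annulus E ε) * (L / 64) := by gcongr
      _ = (L / 8) ^ 2 * volume.real (annulus E ε) := by ring
  · push Not at hlarge
    obtain ⟨x, ⟨hxδ, hxε⟩, hsmall⟩ := hlarge
    have hx : 0 < ‖x‖ := by linarith
    refine .inr (le_trans (ENNReal.ofReal_le_ofReal ?_)
      (ofReal_abs_sub_le_gagliardoHalf_gradient hE hS hF hδ (hδε.trans hxδ).le hxε))
    have hlog : Real.log (‖x‖ / δ) ≤ L := by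
      rw [Real.log_div hx.ne' hδ.ne', hLδ]
      linarith [Real.log_nonpos hx.le (hxε.le.trans hε)]
    calc gagliardoConst E / 2 * L = gagliardoConst E * (L / 2) := by ring
      _ ≤ _ := by
        gcongr
        linarith [neg_abs_le (F ‖x‖ - F δ)]

end Logarithm

theorem ofReal_le_normHThreeHalves {S : Set E3} {f : E3 → ℝ} {c L : ℝ} (hc : 0 ≤ c) (hL : 0 ≤ L)
    (h : ENNReal.ofReal (c * L) ≤ (∫⁻ x in S, ‖f x‖ₑ ^ 2) ∨
      ENNReal.ofReal (c * L) ≤ gagliardoHalf S (gradient f)) :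
    ENNReal.ofReal (√c * L ^ (1 / 2 : ℝ)) ≤ normHThreeHalves S f := by
  rw [Real.sqrt_eq_rpow, ← Real.mul_rpow hc hL,
    ← ENNReal.ofReal_rpow_of_nonneg (by positivity) (by norm_num)]
  refine ENNReal.rpow_le_rpow ?_ (by norm_num)
  simp only [gagliardoHalf, finrank_euclideanSpace_fin] at h
  rcases h with h | h
  · exact h.trans (le_self_add.trans le_self_add)
  · exact h.trans le_add_self

section LogarithmicBlowup

theorem tendsto_abs_log_abs_sub_nhdsLT (t₀ : ℝ) :
    Tendsto (fun t => |Real.log (|t - t₀|)|) (𝓝[<] t₀) atTop := by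
  simp only [Real.log_abs]
  refine tendsto_abs_atBot_atTop.comp (Real.tendsto_log_nhdsNE_zero.comp
    (tendsto_nhdsWithin_of_tendsto_nhds_of_eventually_within _ ?_ ?_))
  · exact tendsto_nhdsWithin_of_tendsto_nhds
      ((continuous_sub_right t₀).tendsto' t₀ 0 (sub_self t₀))
  · filter_upwards [self_mem_nhdsWithin] with t ht using sub_ne_zero.2 (ne_of_lt ht)

theorem eventually_abs_log_abs_sub_eq (t₀ : ℝ) :
    ∀ᶠ t in 𝓝[<] t₀, |Real.log (|t - t₀|)| = -Real.log (t₀ - t) := by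
  filter_upwards [Ioo_mem_nhdsLT (sub_one_lt t₀)] with t ht
  rw [abs_sub_comm, Real.log_abs]
  exact abs_of_neg (Real.log_neg (by linarith [ht.2]) (by linarith [ht.1]))

theorem exists_eventually_add_abs_log_le_neg_log {E : Type*} [NormedAddCommGroup E]
    [NormedSpace ℝ E] {V : E × ℝ → ℝ} {x₀ : E} {t₀ : ℝ} (hV : DifferentiableAt ℝ V (x₀, t₀))
    (h0 : V (x₀, t₀) = 0) :
    ∃ C : ℝ, ∀ᶠ t in 𝓝[<] t₀, ∀ x, ‖x - x₀‖ ≤ t₀ - t → 0 < V (x, t) →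
      C + |Real.log (|t - t₀|)| ≤ -Real.log (V (x, t)) := by
  obtain ⟨M, hM, hbound⟩ := hV.isBigO_sub.exists_pos
  obtain ⟨e, he, hball⟩ := Metric.eventually_nhds_iff.1 hbound.bound
  refine ⟨-Real.log M, ?_⟩
  filter_upwards [eventually_abs_log_abs_sub_eq t₀, Ioo_mem_nhdsLT (sub_lt_self t₀ he)]
    with t hlog ht x hx hpos
  have hδ : 0 < t₀ - t := sub_pos.2 ht.2
  have hnorm : ‖(x, t) - (x₀, t₀)‖ ≤ t₀ - t := max_le hx (by
    rw [Prod.snd_sub, Real.norm_eq_abs, abs_sub_comm, abs_of_pos hδ])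
  have hlinear : V (x, t) ≤ M * (t₀ - t) := by
    have h := hball (y := (x, t)) (by rw [dist_eq_norm]; exact hnorm.trans_lt (by linarith [ht.1]))
    rw [h0, sub_zero] at h
    exact (le_abs_self _).trans (h.trans (by gcongr))
  have hmono := Real.log_le_log hpos hlinear
  rw [Real.log_mul hM.ne' hδ.ne'] at hmono
  linarith

/-- The function `u` with domain `D` blows up logarithmically at the point `(x₀, t₀)`, which is
approached along the time axis through `x₀` from the side of time `0`; `c` is the constant of the
`H^{3/2}` bound. -/
def HasLogBlowup (c : ℝ) (D : Set (E3 × ℝ)) (u : E3 → ℝ → ℝ) (x₀ : E3) (t₀ : ℝ) : Prop :=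
  (x₀, t₀) ∉ D ∧ (∀ t ∈ uIoo 0 t₀, (x₀, t) ∈ D) ∧
    ∃ C : ℝ, ∀ᶠ t in 𝓝[uIoo 0 t₀] t₀,
      ENNReal.ofReal (C + |Real.log (|t - t₀|)|)
          ≤ normLInfty (ballSlice D x₀ t) (fun x => u x t) ∧
      ENNReal.ofReal (c * |Real.log (|t - t₀|)| ^ (1 / 2 : ℝ))
          ≤ normHThreeHalves (ballSlice D x₀ t) (fun x => u x t)

theorem HasLogBlowup.comp_timeReflection {c : ℝ} {D : Set (E3 × ℝ)} {u : E3 → ℝ → ℝ} {x₀ : E3}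
    {t₀ : ℝ} (h : HasLogBlowup c D u x₀ t₀) :
    HasLogBlowup c (timeReflection ⁻¹' D) (fun x t => u x (-t)) x₀ (-t₀) := by
  obtain ⟨hnot, haxis, C, hC⟩ := h
  have hmaps : MapsTo Neg.neg (uIoo 0 (-t₀)) (uIoo 0 t₀) := fun t ht => by
    rw [uIoo, mem_Ioo, inf_lt_iff, lt_sup_iff] at ht ⊢
    grind
  refine ⟨fun hmem => hnot ?_, fun t ht => haxis (-t) (hmaps ht), C, ?_⟩
  · simpa only [mem_preimage, timeReflection_apply, neg_neg] using hmem
  have hneg : Tendsto Neg.neg (𝓝[uIoo 0 (-t₀)] (-t₀)) (𝓝[uIoo 0 t₀] t₀) :=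
    (continuous_neg.tendsto' (-t₀) t₀ (neg_neg t₀)).inf (tendsto_principal_principal.2 hmaps)
  filter_upwards [hneg.eventually hC] with t ht
  have habs : |-t - t₀| = |t - -t₀| := by rw [← abs_neg, neg_sub', neg_neg]
  rwa [habs] at ht

theorem positivityDomain_comp_timeReflection {E : Type*} [NormedAddCommGroup E]
    [InnerProductSpace ℝ E] (V : E × ℝ → ℝ) :
    positivityDomain (V ∘ timeReflection) = timeReflection ⁻¹' positivityDomain V := by
  ext p
  refine ⟨fun h q hq => ?_, fun h q hq => ?_⟩
  · have hmem := h (timeReflection_mem_lightCone hq)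
    rwa [mem_ofPred_eq, Function.comp_apply, timeReflection_timeReflection] at hmem
  · exact h (timeReflection_mem_lightCone (by rwa [timeReflection_timeReflection]))

theorem ballSlice_mem_nhds {D : Set (E3 × ℝ)} (hD : IsOpen D) {x₀ : E3} {t : ℝ}
    (h : (x₀, t) ∈ D) : ballSlice D x₀ t ∈ 𝓝 x₀ := by
  filter_upwards [Metric.closedBall_mem_nhds x₀ one_pos,
    (Continuous.prodMk_left t).continuousAt.preimage_mem_nhds (hD.mem_nhds h)] with x hx hxD
  exact ⟨mem_closedBall_iff_norm.1 hx, hxD⟩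

theorem le_normLInfty {S : Set E3} {f : E3 → ℝ} {x₀ : E3} (hf : ContinuousAt f x₀)
    (hS : S ∈ 𝓝 x₀) {m : ℝ} (hm : m ≤ f x₀) : ENNReal.ofReal m ≤ normLInfty S f := by
  refine le_trans ?_ (enorm_le_eLpNorm_top_restrict volume hf hS)
  rw [Real.enorm_eq_ofReal_abs]
  exact ENNReal.ofReal_le_ofReal (hm.trans (le_abs_self _))

end LogarithmicBlowup

section RadialBlowup

variable {q : ℝ → ℝ} {ρ t : ℝ}

theorem contDiff_weightedMean_abs (hq : ContDiff ℝ ∞ q) (t : ℝ) :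
    ContDiff ℝ ∞ fun r => weightedMean 0 q |r| t :=
  (contDiff_radialMean (E := ℝ) 0 hq).comp (contDiff_prodMk_left t)

theorem contDiffOn_neg_log_weightedMean (hq : ContDiff ℝ ∞ q)
    (hpos : ∀ r ∈ Ico 0 ρ, 0 < weightedMean 0 q r t) :
    ContDiffOn ℝ 1 (fun r => -Real.log (weightedMean 0 q r t)) (Ioo 0 ρ) := by
  have hcongr : ∀ r ∈ Ioo 0 ρ, weightedMean 0 q r t = weightedMean 0 q |r| t := fun r hr => by
    rw [abs_of_pos hr.1]
  refine ContDiffOn.neg (ContDiffOn.log ?_ fun r hr => (hpos r ⟨hr.1.le, hr.2⟩).ne')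
  exact (contDiff_infty.1 (contDiff_weightedMean_abs hq t) 1).contDiffOn.congr hcongr

theorem tendsto_neg_log_atTop_of_pos {f : ℝ → ℝ} {a : ℝ} (hf : ContinuousAt f ρ) (h0 : f ρ = 0)
    (haρ : a < ρ) (hpos : ∀ r ∈ Ico a ρ, 0 < f r) :
    Tendsto (fun r => -Real.log (f r)) (𝓝[<] ρ) atTop := by
  refine tendsto_neg_atBot_atTop.comp (Real.tendsto_log_nhdsGT_zero.comp
    (tendsto_nhdsWithin_of_tendsto_nhds_of_eventually_within _
      (tendsto_nhdsWithin_of_tendsto_nhds (h0 ▸ hf.tendsto)) ?_))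
  filter_upwards [Ioo_mem_nhdsLT haρ] with r hr using hpos r ⟨hr.1.le, hr.2⟩

theorem le_normHThreeHalves_neg_log_radialMean {S : Set E3} {ε δ L : ℝ} (hq : ContDiff ℝ ∞ q)
    (hS : ∀ ρ ≤ ε, (∀ r ∈ Ico 0 ρ, 0 < weightedMean 0 q r t) → Metric.ball 0 ρ ⊆ S)
    (h0 : 0 < weightedMean 0 q 0 t) (hδ : 0 < δ) (hδε : δ < ε / 2) (hε : ε ≤ 1)
    (hLδ : L = -Real.log δ) (hL : 32 * gagliardoConst E3 / volume.real (annulus E3 ε) ≤ L)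
    (hδL : 0 < weightedMean 0 q δ t → 7 / 8 * L ≤ -Real.log (weightedMean 0 q δ t)) :
    ENNReal.ofReal (√(gagliardoConst E3 / 2) * L ^ (1 / 2 : ℝ))
      ≤ normHThreeHalves S fun x => -Real.log (radialMean 0 q (x, t)) := by
  have hconst := gagliardoConst_pos (E := E3)
  have hdim : Module.finrank ℝ E3 = 3 := finrank_euclideanSpace_fin
  have hL0 : 0 ≤ L := hLδ ▸ neg_nonneg.2 (Real.log_nonpos hδ.le (by linarith))
  refine ofReal_le_normHThreeHalves (by positivity) hL0 ?_
  by_cases hpos : ∀ r ∈ Ico 0 ε, 0 < weightedMean 0 q r t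
  · exact le_lintegral_sq_or_le_gagliardoHalf_gradient hdim (hS ε le_rfl hpos)
      (contDiffOn_neg_log_weightedMean hq hpos) hδ hδε hε hLδ hL
      (hδL (hpos δ ⟨hδ.le, by linarith⟩))
  · push Not at hpos
    obtain ⟨r, hr, hneg⟩ := hpos
    have hcont := (contDiff_weightedMean_abs hq t).continuous
    obtain ⟨ρ, ⟨hρ, hρr⟩, hzero, hbefore⟩ := exists_first_zero hcont hr.1
      (by rwa [abs_zero]) (by rwa [abs_of_nonneg hr.1])
    have hbefore' : ∀ s ∈ Ico 0 ρ, 0 < weightedMean 0 q s t := fun s hs => by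
      simpa only [abs_of_nonneg hs.1] using hbefore s hs
    refine .inr (le_top.trans_eq (gagliardoHalf_gradient_eq_top hdim hρ
      (hS ρ (hρr.trans hr.2.le) hbefore') (contDiffOn_neg_log_weightedMean hq hbefore') ?_).symm)
    refine (tendsto_neg_log_atTop_of_pos hcont.continuousAt hzero hρ hbefore).congr' ?_
    filter_upwards [Ioo_mem_nhdsLT hρ] with s hs
    rw [abs_of_pos hs.1]

theorem eventually_ball_subset_ballSlice {t₀ : ℝ} (hq : Continuous q) (ht₀ : 0 < t₀)
    (hpos : ∀ s ∈ Ico 0 t₀, 0 < q s) (hinit : ∀ r, 0 < r → 0 < weightedMean 0 q r 0) :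
    ∀ᶠ ε in 𝓝[>] (0 : ℝ), ∀ t ∈ Ioo (t₀ - ε) t₀, ∀ ρ ≤ ε,
      (∀ r ∈ Ico 0 ρ, 0 < weightedMean 0 q r t) →
      Metric.ball 0 ρ ⊆ ballSlice (positivityDomain (radialMean 0 q)) 0 t := by
  filter_upwards [eventually_weightedMean_pos_of_add_le hq ht₀ hpos hinit,
    Ioo_mem_nhdsGT (lt_min one_pos ht₀)] with ε hε hε1 t ht ρ hρ hmean x hx
  obtain ⟨hε1, hεt⟩ := lt_min_iff.1 hε1.2
  have hxρ := mem_ball_zero_iff.1 hx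
  refine ⟨by rw [sub_zero]; linarith, mem_positivityDomain_radialMean (by linarith [ht.1]) ?_⟩
  exact hε t ht ‖x‖ (by linarith) fun r hr => hmean r ⟨hr.1, hr.2.trans_lt hxρ⟩

theorem hasLogBlowup_neg_log_radialMean {t₀ : ℝ} (hq : ContDiff ℝ ∞ q) (ht₀ : 0 < t₀)
    (hpos : ∀ s ∈ Ico 0 t₀, 0 < q s) (hzero : q t₀ = 0)
    (hinit : ∀ r, 0 < r → 0 < weightedMean 0 q r 0) :
    HasLogBlowup (√(gagliardoConst E3 / 2)) (positivityDomain (radialMean 0 q))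
      (fun x t => -Real.log (radialMean 0 q (x, t))) 0 t₀ := by
  have hV := contDiff_radialMean (E := E3) 0 hq
  have hV0 : radialMean 0 q ((0 : E3), t₀) = 0 := by
    rw [radialMean, norm_zero, weightedMean_radius_zero, hzero, mul_zero]
  have haxis : ∀ t ∈ Ioo 0 t₀, ((0 : E3), t) ∈ positivityDomain (radialMean 0 q) := fun t ht =>
    axis_mem_positivityDomain hq.continuous hpos hinit (Ioo_subset_Ico_self ht)
  obtain ⟨C, hC⟩ := exists_eventually_add_abs_log_le_neg_log
    (hV.differentiable (by simp) _) hV0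
  obtain ⟨ε, hslice, hε0, hε1⟩ := ((eventually_ball_subset_ballSlice hq.continuous ht₀ hpos
    hinit).and (Ioo_mem_nhdsGT (one_pos (α := ℝ)))).exists
  refine ⟨fun h => (pos_of_mem_positivityDomain h).ne' hV0, by rwa [uIoo_of_le ht₀.le], C, ?_⟩
  rw [uIoo_of_le ht₀.le, nhdsWithin_Ioo_eq_nhdsLT ht₀]
  filter_upwards [hC, eventually_abs_log_abs_sub_eq t₀, Ioo_mem_nhdsLT ht₀,
    Ioo_mem_nhdsLT (sub_lt_self t₀ (half_pos hε0)),
    (tendsto_abs_log_abs_sub_nhdsLT t₀).eventually_ge_atTop (-8 * C),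
    (tendsto_abs_log_abs_sub_nhdsLT t₀).eventually_ge_atTop
      (32 * gagliardoConst E3 / volume.real (annulus E3 ε))]
    with t hC hlog ht htε hL_C hL
  have hδ : 0 < t₀ - t := sub_pos.2 ht.2
  have hpos0 := pos_of_mem_positivityDomain (haxis t ht)
  refine ⟨le_normLInfty ?_ (ballSlice_mem_nhds (isOpen_positivityDomain hV.continuous) (haxis t ht))
    (hC 0 (by simpa using hδ.le) hpos0), ?_⟩
  · exact ((hV.continuous.comp (Continuous.prodMk_left t)).continuousAt.log hpos0.ne').neg
  refine le_normHThreeHalves_neg_log_radialMean hq (hslice t ⟨by linarith [htε.1], ht.2⟩)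
    (by simpa [radialMean] using hpos0) hδ (by linarith [htε.1]) hε1.le hlog hL fun hδpos => ?_
  obtain ⟨x, hx⟩ := exists_norm_eq E3 hδ.le
  have hδC : C + |Real.log (|t - t₀|)| ≤ -Real.log (weightedMean 0 q ‖x‖ t) :=
    hC x (by rw [sub_zero, hx]) (by rwa [radialMean, hx])
  rw [hx] at hδC
  linarith

theorem exists_hasLogBlowup_neg_log_radialMean_of_pos (hq : ContDiff ℝ ∞ q)
    (hinit : ∀ r, 0 < weightedMean 0 q r 0) {r₀ : ℝ} (hr₀ : 0 ≤ r₀) (hqr : q r₀ ≤ 0) :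
    ∃ t₀ ∈ Ioc 0 r₀, HasLogBlowup (√(gagliardoConst E3 / 2)) (positivityDomain (radialMean 0 q))
      (fun x t => -Real.log (radialMean 0 q (x, t))) 0 t₀ := by
  have hq0 := hinit 0
  rw [weightedMean_radius_zero] at hq0
  obtain ⟨t₀, ht₀, hzero, hpos⟩ := exists_first_zero hq.continuous hr₀ (by linarith) hqr
  exact ⟨t₀, ht₀, hasLogBlowup_neg_log_radialMean hq ht₀.1 hpos hzero fun r _ => hinit r⟩

theorem exists_hasLogBlowup_neg_log_radialMean (hq : ContDiff ℝ ∞ q)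
    (hinit : ∀ r, 0 < weightedMean 0 q r 0) {r₀ : ℝ} (hr₀ : 0 ≤ r₀)
    (hqr : q r₀ ≤ 0 ∨ q (-r₀) ≤ 0) :
    ∃ t₀ : ℝ, t₀ ≠ 0 ∧ |t₀| ≤ r₀ ∧ HasLogBlowup (√(gagliardoConst E3 / 2))
      (positivityDomain (radialMean 0 q)) (fun x t => -Real.log (radialMean 0 q (x, t))) 0 t₀ := by
  rcases hqr with hqr | hqr
  · obtain ⟨t₀, ht₀, h⟩ := exists_hasLogBlowup_neg_log_radialMean_of_pos hq hinit hr₀ hqr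
    exact ⟨t₀, ht₀.1.ne', (abs_of_pos ht₀.1).trans_le ht₀.2, h⟩
  · have hreflect : radialMean (E := E3) 0 q
        = radialMean 0 (fun s => q (-s)) ∘ timeReflection := by
      funext p
      rw [Function.comp_apply, timeReflection_apply, radialMean_comp_neg, neg_neg]
    obtain ⟨t₀, ht₀, h⟩ := exists_hasLogBlowup_neg_log_radialMean_of_pos (q := fun s => q (-s))
      (hq.comp contDiff_neg) (fun r => by
        rw [← weightedMean_neg_time, neg_zero]
        exact hinit r) hr₀ hqr
    refine ⟨-t₀, neg_ne_zero.2 ht₀.1.ne', by rw [abs_neg, abs_of_pos ht₀.1]; exact ht₀.2, ?_⟩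
    rw [hreflect, positivityDomain_comp_timeReflection]
    exact h.comp_timeReflection

end RadialBlowup

section WaveProfile

/-- The function whose means `∫ σ in -1..1, waveProfile α β (t + σ |x|)` solve the linear wave
equation in three dimensions with data `v(0) = α(|x|)`, `v_t(0) = β(|x|)`. -/
noncomputable def waveProfile (α β : ℝ → ℝ) (s : ℝ) : ℝ :=
  (deriv (fun s => s * α s) s + s * β s) / 2

variable {α β : ℝ → ℝ}

theorem contDiff_waveProfile (hα : ContDiff ℝ ∞ α) (hβ : ContDiff ℝ ∞ β) :
    ContDiff ℝ ∞ (waveProfile α β) :=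
  ((contDiff_infty_deriv (contDiff_id.mul hα)).add (contDiff_id.mul hβ)).div_const 2

theorem waveProfile_apply {s : ℝ} (hα : DifferentiableAt ℝ α s) :
    waveProfile α β s = (α s + s * deriv α s + s * β s) / 2 := by
  rw [waveProfile, ((hasDerivAt_id' s).fun_mul hα.hasDerivAt).deriv, one_mul]

theorem odd_id_mul {f : ℝ → ℝ} (hf : f.Even) : (fun s => s * f s).Odd := fun s => by
  simp only [hf s, neg_mul]

theorem weightedMean_waveProfile (hα : ContDiff ℝ ∞ α) (hβ : Continuous β) (hαe : α.Even)
    (hβe : β.Even) (r : ℝ) : weightedMean 0 (waveProfile α β) r 0 = α r := by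
  have hα' : ContDiff ℝ ∞ fun s => s * α s := contDiff_id.mul hα
  unfold waveProfile
  rw [weightedMean_half_add (contDiff_infty_deriv hα').continuous (continuous_id'.fun_mul hβ),
    weightedMean_deriv_id_mul_of_even (contDiff_infty.1 hα 1) hαe,
    weightedMean_time_zero_of_odd (odd_id_mul hβe)]
  ring

theorem weightedMean_deriv_waveProfile (hα : ContDiff ℝ ∞ α) (hβ : ContDiff ℝ ∞ β)
    (hαe : α.Even) (hβe : β.Even) (r : ℝ) :
    weightedMean 0 (deriv (waveProfile α β)) r 0 = β r := by
  have hα' : ContDiff ℝ ∞ (deriv fun s => s * α s) := contDiff_infty_deriv (contDiff_id.mul hα)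
  have hβ' : ContDiff ℝ ∞ fun s => s * β s := contDiff_id.mul hβ
  have hderiv : deriv (waveProfile α β) = fun s =>
      (deriv (deriv fun s => s * α s) s + deriv (fun s => s * β s) s) / 2 := by
    funext s
    exact (((hα'.differentiable (by simp) s).hasDerivAt.add
      (hβ'.differentiable (by simp) s).hasDerivAt).div_const 2).deriv
  rw [hderiv, weightedMean_half_add (contDiff_infty_deriv hα').continuous
    (contDiff_infty_deriv hβ').continuous,
    weightedMean_deriv_id_mul_of_even (contDiff_infty.1 hβ 1) hβe,
    weightedMean_time_zero_of_odd (deriv_odd_of_even (deriv_even_of_odd (odd_id_mul hαe)))]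
  ring

end WaveProfile

section HopfCole

/-- The wave profile of `v = e^{-u}`, where `u` has the radial data `u(0) = g(|x|)`,
`u_t(0) = h(|x|)`. -/
noncomputable def hopfColeProfile (g h : ℝ → ℝ) : ℝ → ℝ :=
  waveProfile (fun s => Real.exp (-g s)) fun s => -h s * Real.exp (-g s)

variable {g h : ℝ → ℝ}

theorem contDiff_hopfColeProfile (hg : ContDiff ℝ ∞ g) (hh : ContDiff ℝ ∞ h) :
    ContDiff ℝ ∞ (hopfColeProfile g h) :=
  contDiff_waveProfile hg.neg.exp (hh.neg.mul hg.neg.exp)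

theorem weightedMean_hopfColeProfile (hg : ContDiff ℝ ∞ g) (hh : Continuous h) (hge : g.Even)
    (hhe : h.Even) (r : ℝ) : weightedMean 0 (hopfColeProfile g h) r 0 = Real.exp (-g r) :=
  weightedMean_waveProfile (β := fun s => -h s * Real.exp (-g s)) hg.neg.exp
    (hh.neg.mul hg.neg.exp.continuous)
    (fun s => by simp only [hge s]) (fun s => by simp only [hge s, hhe s]) r

theorem weightedMean_deriv_hopfColeProfile (hg : ContDiff ℝ ∞ g) (hh : ContDiff ℝ ∞ h)
    (hge : g.Even) (hhe : h.Even) (r : ℝ) :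
    weightedMean 0 (deriv (hopfColeProfile g h)) r 0 = -h r * Real.exp (-g r) :=
  weightedMean_deriv_waveProfile hg.neg.exp (hh.neg.mul hg.neg.exp)
    (fun s => by simp only [hge s]) (fun s => by simp only [hge s, hhe s]) r

theorem hopfColeProfile_apply {s : ℝ} (hg : DifferentiableAt ℝ g s) :
    hopfColeProfile g h s = Real.exp (-g s) / 2 * (1 - s * (deriv g s + h s)) := by
  rw [hopfColeProfile, waveProfile_apply hg.fun_neg.exp, hg.hasDerivAt.fun_neg.exp.deriv]
  ring

theorem hopfColeProfile_nonpos_of_one_le {s : ℝ} (hg : DifferentiableAt ℝ g s)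
    (hle : 1 ≤ s * (deriv g s + h s)) : hopfColeProfile g h s ≤ 0 := by
  rw [hopfColeProfile_apply hg]
  exact mul_nonpos_of_nonneg_of_nonpos (by positivity) (by linarith)

theorem hopfColeProfile_nonpos_or_neg_nonpos {r₀ : ℝ} (hg : Differentiable ℝ g) (hge : g.Even)
    (hhe : h.Even) (hr₀ : 0 < r₀) (hle : 1 / r₀ ≤ deriv g r₀ + |h r₀|) :
    hopfColeProfile g h r₀ ≤ 0 ∨ hopfColeProfile g h (-r₀) ≤ 0 := by
  rw [div_le_iff₀' hr₀] at hle
  rcases abs_cases (h r₀) with ⟨habs, -⟩ | ⟨habs, -⟩ <;> rw [habs] at hle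
  · exact .inl (hopfColeProfile_nonpos_of_one_le (hg r₀) hle)
  · refine .inr (hopfColeProfile_nonpos_of_one_le (hg (-r₀)) ?_)
    rw [hhe, deriv_odd_of_even hge]
    linarith

end HopfCole

section RadialProfile

variable {f : E3 → ℝ}

theorem contDiff_radialProfile (hf : ContDiff ℝ ∞ f) : ContDiff ℝ ∞ (radialProfile f) := by
  have hray : ContDiff ℝ ∞ fun r : ℝ => (EuclideanSpace.single 0 r : E3) :=
    contDiff_euclidean.2 fun i => by
      simp only [PiLp.single_apply]
      split_ifs <;> fun_prop
  exact hf.comp hray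

theorem IsRadial.even_radialProfile (hf : IsRadial f) : (radialProfile f).Even := fun r =>
  hf _ _ (by simp)

theorem IsRadial.radialProfile_norm (hf : IsRadial f) (x : E3) : radialProfile f ‖x‖ = f x :=
  hf _ _ (by simp)

theorem isMaximalSolution_radial {u₀ u₁ : E3 → ℝ} (hu₀ : ContDiff ℝ ∞ u₀) (hu₁ : ContDiff ℝ ∞ u₁)
    (hr₀ : IsRadial u₀) (hr₁ : IsRadial u₁) :
    let V := radialMean (E := E3) 0 (hopfColeProfile (radialProfile u₀) (radialProfile u₁))
    IsMaximalSolution u₀ u₁ (positivityDomain V) fun x t => -Real.log (V (x, t)) := by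
  have hg := contDiff_radialProfile hu₀
  have hh := contDiff_radialProfile hu₁
  have hq := contDiff_hopfColeProfile hg hh
  refine isMaximalSolution_neg_log (contDiff_infty.1 (contDiff_radialMean 0 hq) 2)
    (waveOp_radialMean (by simp) hq) (fun x => ?_) fun x => ?_
  · rw [radialMean, weightedMean_hopfColeProfile hg hh.continuous hr₀.even_radialProfile
      hr₁.even_radialProfile, hr₀.radialProfile_norm]
  · rw [dirDeriv_time_radialMean 0 (contDiff_infty.1 hq 2), radialMean,
      weightedMean_deriv_hopfColeProfile hg hh hr₀.even_radialProfile hr₁.even_radialProfile,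
      hr₀.radialProfile_norm, hr₁.radialProfile_norm]

end RadialProfile

theorem mainTheorem8 :
    ∃ c : ℝ, 0 < c ∧
      ∀ (u₀ u₁ : E3 → ℝ), ContDiff ℝ ∞ u₀ → ContDiff ℝ ∞ u₁ → IsRadial u₀ → IsRadial u₁ →
      ∀ r₀ : ℝ, 0 < r₀ →
        1 / r₀ ≤ deriv (radialProfile u₀) r₀ + |radialProfile u₁ r₀| →
        ∃ (D : Set (E3 × ℝ)) (u : E3 → ℝ → ℝ),
          IsMaximalSolution u₀ u₁ D u ∧
          ContDiffOn ℝ ∞ (fun p : E3 × ℝ => u p.1 p.2) D ∧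
          ∃ (t₀ : ℝ) (x₀ : E3),
            t₀ ≠ 0 ∧ |t₀| ≤ r₀ ∧
            (x₀, t₀) ∉ D ∧
            (∀ t ∈ uIoo 0 t₀, (x₀, t) ∈ D) ∧
            ∃ C : ℝ, ∀ᶠ t in 𝓝[uIoo 0 t₀] t₀,
              ENNReal.ofReal (C + |Real.log (|t - t₀|)|)
                  ≤ normLInfty (ballSlice D x₀ t) (fun x => u x t) ∧
              ENNReal.ofReal (c * |Real.log (|t - t₀|)| ^ (1 / 2 : ℝ))
                  ≤ normHThreeHalves (ballSlice D x₀ t) (fun x => u x t) := by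
  have hconst := gagliardoConst_pos (E := E3)
  refine ⟨√(gagliardoConst E3 / 2), by positivity, ?_⟩
  intro u₀ u₁ hu₀ hu₁ hrad₀ hrad₁ r₀ hr₀ hcond
  have hg := contDiff_radialProfile hu₀
  have hh := contDiff_radialProfile hu₁
  have hq := contDiff_hopfColeProfile hg hh
  have hge := hrad₀.even_radialProfile
  have hhe := hrad₁.even_radialProfile
  obtain ⟨t₀, ht₀, htr, hblowup⟩ := exists_hasLogBlowup_neg_log_radialMean hq
    (fun r => by
      rw [weightedMean_hopfColeProfile hg hh.continuous hge hhe]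
      exact Real.exp_pos _)
    hr₀.le (hopfColeProfile_nonpos_or_neg_nonpos (hg.differentiable (by simp)) hge hhe hr₀ hcond)
  exact ⟨_, _, isMaximalSolution_radial hu₀ hu₁ hrad₀ hrad₁,
    contDiffOn_neg_log (contDiff_radialMean 0 hq), t₀, 0, ht₀, htr, hblowup⟩
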